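/- Let $G$ be a locally finite, connected metric graph with at least one edge: a countable family of compact edges $e\cong[0,\ell_e]$, $0<\ell_e<\infty$, glued at their endpoints so that every vertex has finite degree (no upper or positive lower bound on the $\ell_e$ is assumed). Suppose that $G$ is a tree, i.e. contains no cycles (in particular no loops or parallel edges). An end of $G$ is an equivalence class of rays (sequences of distinct, consecutively adjacent vertices), two rays being equivalent if a third ray contains infinitely many vertices of both; $\overline G$ denotes $G$ together with its set of ends $\mathfrak C(G)$, with its canonical path distance. Fix a vertex $c$ and let $$\mathfrak V=\mathfrak C(G)\cup\{v \text{ a vertex}:\deg v=1,\ v\neq c\}.$$ Let $\mathcal H_{\mathfrak V}$ be the self-adjoint operator in $L^2(G)$ associated with the form $f\mapsto\int_G|f'|^2\,dx$ on $H^1_0(G;\mathfrak V)=\{f\in H^1(G): f=0\text{ on }\mathfrak V\}$, where $H^1(G)$ consists of the continuous functions on $G$ that are absolutely continuous on each edge and lie in $L^2(G)$ together with their derivative, and the value of $f$ at an end is its limit along the rays of that end. Let $\operatorname{Inr}(G,\mathfrak V)\in[0,\infty]$ be the supremum of the radii of closed balls in $\overline G$ that do not intersect $\mathfrak V$. **Theorem.**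 Assume that $\operatorname{Inr}(G,\mathfrak V)<\infty$ and that $c$ is a centre vertex, i.e. $\operatorname{dist}(c,\gamma_1)=\operatorname{dist}(c,\gamma_2)$ for all $\gamma_1,\gamma_2\in\mathfrak V$. Then $\mathcal H_{\mathfrak V}$ has a lowest eigenvalue $\lambda_1(G,\mathfrak V)$, and $$\lambda_1(G,\mathfrak V)\ \ge\ \frac{\pi^2}{4\operatorname{Inr}(G,\mathfrak V)^2}.$$ -/

import Mathlib

/-- A metric graph with vertex set `V` and edge set `E`: every edge `e` is a copy of the interval
`[0, len e]`, `0 < len e < ∞`, whose endpoints `0` and `len e` are glued to the vertices `init e`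
and `term e`. Loops and parallel edges are allowed. -/
structure MetricGraph (V : Type*) (E : Type*) where
  init : E → V
  term : E → V
  len : E → ℝ
  len_pos : ∀ e, 0 < len e

namespace MetricGraph

open Set Filter Topology MeasureTheory
open scoped ENNReal NNReal

noncomputable section

universe u v

variable {V : Type u} {E : Type v} (G : MetricGraph V E)

/-! ### Combinatorial notions -/

/-- The edge `e` joins the vertices `a` and `b` (in either direction). -/
def Joins (e : E) (a b : V) : Prop :=
  (G.init e = a ∧ G.term e = b) ∨ (G.init e = b ∧ G.term e = a)

/-- The degree of a vertex: the number of incident edges, loops counted twice. -/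
def degree (a : V) : ℕ∞ := {e | G.init e = a}.encard + {e | G.term e = a}.encard

/-- All vertex degrees are finite. -/
def LocallyFinite : Prop := ∀ a, G.degree a ≠ ⊤

/-- Two different vertices are adjacent if some edge joins them. -/
def toSimpleGraph : SimpleGraph V where
  Adj a b := a ≠ b ∧ ∃ e, G.Joins e a b
  symm := by
    constructor
    rintro a b ⟨h, e, he⟩
    exact ⟨h.symm, e, Or.symm he⟩
  loopless := ⟨fun _ h => h.1 rfl⟩

/-- A (connected) tree: the adjacency graph is connected without cycles, and there are neither
loops nor parallel edges. -/
structure IsTree : Prop where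
  isTree : G.toSimpleGraph.IsTree
  no_loop : ∀ e, G.init e ≠ G.term e
  no_parallel : ∀ e e', G.Joins e' (G.init e) (G.term e) → e' = e

/-- A ray: a sequence of distinct vertices, consecutive ones being joined by an edge. -/
structure Ray where
  vert : ℕ → V
  edge : ℕ → E
  vert_injective : Function.Injective vert
  joins : ∀ n, G.Joins (edge n) (vert n) (vert (n + 1))

variable {G} in
/-- Two rays are equivalent if a third one contains infinitely many vertices of both. -/
def Ray.Equiv (r₁ r₂ : G.Ray) : Prop :=
  ∃ r₃ : G.Ray, (range r₁.vert ∩ range r₃.vert).Infinite ∧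
    (range r₂.vert ∩ range r₃.vert).Infinite

/-- The ends of the graph: equivalence classes of rays. -/
def End : Type (max u v) := Quot (Ray.Equiv (G := G))

variable {G} in
/-- The end to which a ray belongs. -/
def Ray.toEnd (r : G.Ray) : G.End := Quot.mk _ r

variable {G} in
/-- The total length of a ray. -/
def Ray.length (r : G.Ray) : ℝ≥0∞ := ∑' n, ENNReal.ofReal (G.len (r.edge n))

/-! ### The metric graph as a metric measure space -/

/-- The points of the metric graph: the vertices, and the interior points of the edges. -/
inductive Point (G : MetricGraph V E) : Type (max u v)
  | vertex (a : V) : Point G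
  | inner (e : E) (t : ℝ) (ht : t ∈ Ioo 0 (G.len e)) : Point G

open Classical in
/-- The parametrization `[0, len e] → G` of the edge `e`, extended to `ℝ` by constants. -/
def pt (e : E) (t : ℝ) : G.Point :=
  if h : t ∈ Ioo 0 (G.len e) then .inner e t h
  else if t ≤ 0 then .vertex (G.init e) else .vertex (G.term e)

/-- The distance of two points measured inside one closed edge (`∞` if they do not lie on a common
edge). -/
def edgeDist (p q : G.Point) : ℝ≥0∞ :=
  ⨅ (e : E) (s ∈ Icc 0 (G.len e)) (t ∈ Icc 0 (G.len e)) (_ : G.pt e s = p) (_ : G.pt e t = q),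
    ENNReal.ofReal |s - t|

/-- The canonical distance on the metric graph: the infimum of the lengths of finite chains of
points, consecutive points lying on a common edge. -/
def pointDist (p q : G.Point) : ℝ≥0∞ :=
  ⨅ (n : ℕ) (x : ℕ → G.Point) (_ : x 0 = p) (_ : x n = q),
    ∑ i ∈ Finset.range n, G.edgeDist (x i) (x (i + 1))

/-- The distance of a point from an end: the infimum over the rays `r` of this end of the
distance from the point to the starting vertex of `r` plus the length of `r`. -/
def endDist (p : G.Point) (γ : G.End) : ℝ≥0∞ :=
  ⨅ (r : G.Ray) (_ : r.toEnd = γ), G.pointDist p (.vertex (r.vert 0)) + r.length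

/-- The graph together with its ends. -/
abbrev Closure : Type (max u v) := G.Point ⊕ G.End

open Classical in
/-- The canonical distance on the graph together with its ends. -/
def closureDist : G.Closure → G.Closure → ℝ≥0∞
  | .inl p, .inl q => G.pointDist p q
  | .inl p, .inr γ => G.endDist p γ
  | .inr γ, .inl p => G.endDist p γ
  | .inr γ, .inr γ' => if γ = γ' then 0 else ⨅ p, G.endDist p γ + G.endDist p γ'

/-- The inradius with respect to a set `S`: the supremum of the radii of closed balls in
the graph together with its ends that do not intersect `S`. -/
def inradius (S : Set G.Closure) : ℝ≥0∞ :=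
  ⨆ (x : G.Closure) (r : ℝ≥0) (_ : Disjoint {y | G.closureDist x y ≤ r} S), (r : ℝ≥0∞)

/-- A set of points is measurable if its trace on every edge is a Borel set. -/
instance : MeasurableSpace G.Point :=
  ⨅ e, (inferInstance : MeasurableSpace ℝ).map (G.pt e)

/-- The sum of the Lebesgue measures of the edges. -/
def vol : Measure G.Point :=
  Measure.sum fun e => (volume.restrict (Icc 0 (G.len e))).map (G.pt e)

/-! ### Sobolev spaces and the Laplacian -/

variable {G}

/-- The derivative of a function along the edges (the vertices form a null set). -/
def edgeDeriv (f : G.Point → ℝ) : G.Point → ℝ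
  | .vertex _ => 0
  | .inner e t _ => deriv (fun s => f (G.pt e s)) t

/-- The Sobolev space `H¹(G)`: the functions on `G` which are absolutely continuous on every closed
edge (hence continuous on `G`, if `G` is locally finite) and belong to `L²(G)` together with their
derivative. -/
structure MemH1 (f : G.Point → ℝ) : Prop where
  absCont : ∀ e, AbsolutelyContinuousOnInterval (fun s => f (G.pt e s)) 0 (G.len e)
  memLp : MemLp f 2 G.vol
  memLp_deriv : MemLp (edgeDeriv f) 2 G.vol

/-- The Sobolev space `H¹₀(G; S)` of the functions in `H¹(G)` that vanish on `S`. The value of an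
`H¹`-function at an end is its limit along the rays that belong to this end. -/
structure MemH10 (S : Set G.Closure) (f : G.Point → ℝ) : Prop where
  memH1 : MemH1 f
  eq_zero : ∀ p : G.Point, Sum.inl p ∈ S → f p = 0
  tendsto_zero : ∀ r : G.Ray, Sum.inr r.toEnd ∈ S →
    Tendsto (fun n => f (.vertex (r.vert n))) atTop (𝓝 0)

/-- The quadratic form `∫ f' h'`. -/
def form (f h : G.Point → ℝ) : ℝ := ∫ p, edgeDeriv f p * edgeDeriv h p ∂G.vol

/-- The graph of the operator in `L²(G)` which is associated with the form `∫ f' h'` on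
`H¹₀(G; S)`: the function `u` is in the domain and is mapped to `w` if and only if `u` belongs
to the form domain and `∫ u' h' = ∫ w h` for all `h` in the form domain. -/
def laplacianGraph (S : Set G.Closure) : Set (Lp ℝ 2 G.vol × Lp ℝ 2 G.vol) :=
  {uw | ∃ f : G.Point → ℝ, MemH10 S f ∧ uw.1 =ᵐ[G.vol] f ∧
    ∀ h : G.Point → ℝ, MemH10 S h → form f h = ∫ p, uw.2 p * h p ∂G.vol}

/-- The eigenvalues of the Laplacian with Dirichlet conditions at `S`. -/
def eigenvalues (S : Set G.Closure) : Set ℝ :=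
  {lam | ∃ u : Lp ℝ 2 G.vol, u ≠ 0 ∧ (u, lam • u) ∈ laplacianGraph S}

variable (G)

/-! ### Trees with a centre vertex -/

/-- The Dirichlet set of a tree with distinguished vertex `c`: all ends and all vertices of degree
one other than `c`. -/
def dirichletSet (c : V) : Set G.Closure :=
  range Sum.inr ∪ {x | ∃ a, a ≠ c ∧ G.degree a = 1 ∧ x = Sum.inl (.vertex a)}

/-- The vertex `c` is equidistant to all elements of the Dirichlet set. -/
def IsCentre (c : V) : Prop :=
  ∀ x ∈ G.dirichletSet c, ∀ y ∈ G.dirichletSet c,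
    G.closureDist (.inl (.vertex c)) x = G.closureDist (.inl (.vertex c)) y

end

end MetricGraph

namespace MetricGraph

open Set Filter Topology MeasureTheory
open scoped ENNReal NNReal

noncomputable section

universe u v

variable {V : Type u} {E : Type v} {G : MetricGraph V E}

/-! ### Rooted trees -/

/-! Root the tree at `c` and measure the height of a point by its distance from `c`. The centre
condition puts every leaf and every end at one distance `R` from `c`. Every edge continues outward
to a leaf or to an end, so all heights are at most `R` (`height_outer_le`). Balls around `c` of
radius less than `R` miss the Dirichlet set, so `R` is at most the inradius
(`closureDist_root_le_inradius`), and it suffices to prove the bound with `R` in its place.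

The bound is a Friedrichs inequality obtained from Picone's identity. For `κ < π / (2 R)` the
function `w = κ tan (κ x)` of the height `x` solves `w' = κ ^ 2 + w ^ 2`, so `f' ^ 2 + (f ^ 2 w)' -
κ ^ 2 f ^ 2 = (f' + w f) ^ 2 ≥ 0` on every edge oriented outward. Branching is handled by choosing
one continuation of each edge. This splits the tree into disjoint chains, each running to a leaf or
an end (`tsum_eq_tsum_chainSum`). On a chain the boundary terms telescope: the last one vanishes
with `f`, since `w` stays bounded, and the first one is nonnegative (`picone_chain`). Summing over
the chains and letting `κ` tend to `π / (2 R)` gives `mul_integral_sq_le_form`.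

That the infimum of the Rayleigh quotient is attained follows from the same inequality with the
tangent shifted to start at height `x₀`. For `x₀` close to `R` it shows that the part of the tree
above `x₀` carries little mass. Only finitely many edges start below that height, by a König
argument (`finite_height_le`), and there the mass is controlled by finitely many point values
(`exists_integral_sq_le_sample`). For `x₀ = -1` the first boundary term bounds the values of `f`
pointwise (`exists_sq_le_mul_form`). A minimizing sequence therefore converges in energy
(`exists_minimizer`), and its limit is an eigenfunction for the least eigenvalue
(`isLeast_eigenvalues_of_minimizer`). -/

/-- The orientation of the edges of a tree away from a root `c`, together with the combinatorial
and the metric distance of the vertices from the root. -/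
structure Rooting (G : MetricGraph V E) (c : V) where
  inner : E → V
  outer : E → V
  depth : V → ℕ
  height : V → ℝ
  joins : ∀ e, G.Joins e (inner e) (outer e)
  outer_injective : Function.Injective outer
  exists_outer : ∀ v, v ≠ c → ∃ e, outer e = v
  depth_root : depth c = 0
  depth_outer : ∀ e, depth (outer e) = depth (inner e) + 1
  height_root : height c = 0
  height_outer : ∀ e, height (outer e) = height (inner e) + G.len e

lemma IsTree.adj_of_joins (h : G.IsTree) {e : E} {a b : V} (hj : G.Joins e a b) :
    G.toSimpleGraph.Adj a b := by
  refine ⟨?_, e, hj⟩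
  have := h.no_loop e
  rcases hj with ⟨rfl, rfl⟩ | ⟨rfl, rfl⟩
  · exact this
  · exact this.symm

lemma IsTree.eq_of_joins (h : G.IsTree) {e e' : E} {a b : V} (hj : G.Joins e a b)
    (hj' : G.Joins e' a b) : e' = e := by
  apply h.no_parallel
  rcases hj with ⟨rfl, rfl⟩ | ⟨rfl, rfl⟩
  · exact hj'
  · exact hj'.symm

/-- Shortest walks to `a` and `b`, prolonged to `v`, are again shortest, hence paths. A tree has
only one path from `c` to `v`, so the penultimate vertices agree. This makes the parent of a vertex
unique. -/
lemma _root_.SimpleGraph.IsTree.eq_of_dist_add_one {T : SimpleGraph V} (h : T.IsTree) {c v a b : V}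
    (ha : T.Adj a v) (hb : T.Adj b v) (hda : T.dist c v = T.dist c a + 1)
    (hdb : T.dist c v = T.dist c b + 1) : a = b := by
  obtain ⟨p, hp, hp'⟩ := h.connected.exists_path_of_dist c a
  obtain ⟨q, hq, hq'⟩ := h.connected.exists_path_of_dist c b
  have h1 : (p.concat ha).IsPath := SimpleGraph.Walk.isPath_of_length_eq_dist _ (by simp [hda, hp'])
  have h2 : (q.concat hb).IsPath := SimpleGraph.Walk.isPath_of_length_eq_dist _ (by simp [hdb, hq'])
  have h3 : p.concat ha = q.concat hb := by
    have := h.isAcyclic.subsingleton_path c v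
    simpa using Subsingleton.elim (α := T.Path c v) ⟨_, h1⟩ ⟨_, h2⟩
  obtain ⟨h4, -⟩ := SimpleGraph.Walk.concat_inj h3
  exact h4

lemma IsTree.exists_rooting (h : G.IsTree) (c : V) : Nonempty (Rooting G c) := by
  classical
  set T := G.toSimpleGraph
  have hT : T.IsTree := h.isTree
  have key : ∀ e, ∃ p : V × V, G.Joins e p.1 p.2 ∧ T.dist c p.2 = T.dist c p.1 + 1 := by
    intro e
    have hadj : T.Adj (G.init e) (G.term e) := h.adj_of_joins (Or.inl ⟨rfl, rfl⟩)
    rcases hT.dist_eq_dist_add_one_of_adj c hadj with h1 | h1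
    · exact ⟨(G.term e, G.init e), Or.inr ⟨rfl, rfl⟩, h1⟩
    · exact ⟨(G.init e, G.term e), Or.inl ⟨rfl, rfl⟩, h1⟩
  choose p hpj hpd using key
  have hinj : Function.Injective fun e => (p e).2 := by
    intro e e' hee
    have hee : (p e).2 = (p e').2 := hee
    have h1 : (p e).1 = (p e').1 := by
      refine hT.eq_of_dist_add_one (c := c) (h.adj_of_joins (hpj e)) ?_ (hpd e) ?_
      · rw [hee]; exact h.adj_of_joins (hpj e')
      · rw [hee]; exact hpd e'
    have h2 := hpj e'
    rw [← h1, ← hee] at h2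
    exact (h.eq_of_joins (hpj e) h2).symm
  have hex : ∀ v, v ≠ c → ∃ e, (p e).2 = v := by
    intro v hv
    obtain ⟨q, hq⟩ := hT.connected.exists_walk_length_eq_dist v c
    revert hq
    cases q with
    | nil => exact absurd rfl hv
    | @cons _ w _ hadj q =>
      intro hq
      obtain ⟨e, he⟩ := hadj.2
      have hw : T.dist c w < T.dist c v := by
        rw [SimpleGraph.dist_comm (u := c) (v := v), ← hq, SimpleGraph.dist_comm,
          SimpleGraph.Walk.length_cons]
        exact Nat.lt_succ_of_le (SimpleGraph.dist_le q)
      refine ⟨e, ?_⟩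
      have h1 := hpj e
      have h2 := hpd e
      rcases he with ⟨h3, h4⟩ | ⟨h3, h4⟩ <;> rcases h1 with ⟨h5, h6⟩ | ⟨h5, h6⟩
      · rw [← h5, ← h6, h3, h4] at h2; omega
      · rw [← h5, h3]
      · rw [← h6, h4]
      · rw [← h5, ← h6, h3, h4] at h2; omega
  choose par hpar using hex
  -- The height is defined by recursion on a step counter, later set equal to the depth: each step
  -- adds the length of the chosen parent edge.
  let H : ℕ → V → ℝ := fun n => n.rec (fun _ => 0) fun _ g v =>
    if hv : v = c then 0 else g (p (par v hv)).1 + G.len (par v hv)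
  refine ⟨⟨fun e => (p e).1, fun e => (p e).2, T.dist c, fun v => H (T.dist c v) v, hpj, hinj,
    fun v hv => ⟨par v hv, hpar v hv⟩, by simp, hpd, by simp [H], fun e => ?_⟩⟩
  have hne : (p e).2 ≠ c := by
    intro h0
    have := hpd e
    rw [h0] at this
    simp at this
  have hpe : par _ hne = e := hinj (hpar _ hne)
  change H (T.dist c (p e).2) (p e).2 = _
  rw [hpd e]
  change (if hv : (p e).2 = c then 0 else
    H (T.dist c (p e).1) (p (par (p e).2 hv)).1 + G.len (par (p e).2 hv)) = _
  rw [dif_neg hne, hpe]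

/-! ### Elementary properties of rootings. -/

namespace Rooting

variable {c : V} (T : Rooting G c)

lemma outer_ne_root (e : E) : T.outer e ≠ c := by
  intro h
  have := T.depth_outer e
  rw [h, T.depth_root] at this
  omega

lemma joins_iff {e : E} {a b : V} : G.Joins e a b ↔
    (a = T.inner e ∧ b = T.outer e) ∨ (a = T.outer e ∧ b = T.inner e) := by
  have := T.joins e
  unfold Joins at *
  grind

lemma height_inner_lt (e : E) : T.height (T.inner e) < T.height (T.outer e) := by
  rw [T.height_outer]; linarith [G.len_pos e]

lemma height_nonneg (v : V) : 0 ≤ T.height v := by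
  induction hn : T.depth v using Nat.strong_induction_on generalizing v with
  | _ n ih =>
    by_cases hv : v = c
    · rw [hv, T.height_root]
    · obtain ⟨e, rfl⟩ := T.exists_outer v hv
      have := ih _ (by rw [← hn, T.depth_outer]; omega) (T.inner e) rfl
      linarith [T.height_inner_lt e]

lemma finite_incident (hfin : G.LocallyFinite) (v : V) : {e | T.inner e = v}.Finite := by
  have h := hfin v
  unfold degree at h
  rw [ne_eq, ENat.add_eq_top, not_or] at h
  refine ((Set.encard_ne_top_iff.1 h.1).union (Set.encard_ne_top_iff.1 h.2)).subset ?_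
  intro e he
  have := T.joins e
  unfold Joins at this
  simp only [mem_ofPred_eq] at he
  rcases this with h | h
  · left; simp [h.1, he]
  · right; simp [h.2, he]

/-- Without an outgoing edge, the only edge incident to `v` is the one leading to it from the root.
It is not a loop, because the depths of its endpoints differ, so `v` would have degree one. -/
lemma exists_inner_of_degree_ne_one {v : V} (hv : v ≠ c) (hd : G.degree v ≠ 1)  :
    ∃ e, T.inner e = v := by
  by_contra! hne
  obtain ⟨e, rfl⟩ := T.exists_outer v hv
  apply hd
  have hu : ∀ e', T.outer e' = T.outer e → e' = e := fun e' h => T.outer_injective h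
  have hd' := T.depth_outer e
  have hio : T.inner e ≠ T.outer e := fun h => by rw [h] at hd'; omega
  have key : ∀ e', (G.init e' = T.outer e ∨ G.term e' = T.outer e) → e' = e := by
    intro e' he'
    have := T.joins e'
    unfold Joins at this
    grind
  unfold degree
  have hj := T.joins e
  rcases hj with ⟨h1, h2⟩ | ⟨h1, h2⟩
  · have e1 : {e' | G.init e' = T.outer e} = ∅ := by
      ext e'; simp only [mem_ofPred_eq, mem_empty_iff_false, iff_false]
      intro h; obtain rfl := key e' (Or.inl h); exact hio (h1.symm.trans h)
    have e2 : {e' | G.term e' = T.outer e} = {e} := by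
      ext e'; simp only [mem_ofPred_eq, mem_singleton_iff]
      exact ⟨fun h => key e' (Or.inr h), fun h => h ▸ h2⟩
    rw [e1, e2]; simp
  · have e1 : {e' | G.term e' = T.outer e} = ∅ := by
      ext e'; simp only [mem_ofPred_eq, mem_empty_iff_false, iff_false]
      intro h; obtain rfl := key e' (Or.inr h); exact hio (h2.symm.trans h)
    have e2 : {e' | G.init e' = T.outer e} = {e} := by
      ext e'; simp only [mem_ofPred_eq, mem_singleton_iff]
      exact ⟨fun h => key e' (Or.inl h), fun h => h ▸ h1⟩
    rw [e1, e2]; simp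

lemma exists_inner_eq_root [Nonempty E] : ∃ e, T.inner e = c := by
  obtain ⟨e⟩ := ‹Nonempty E›
  induction hn : T.depth (T.inner e) generalizing e with
  | zero =>
    refine ⟨e, ?_⟩
    by_contra h
    obtain ⟨e', he'⟩ := T.exists_outer _ h
    have := T.depth_outer e'
    rw [he'] at this
    omega
  | succ n ih =>
    have h : T.inner e ≠ c := fun h => by rw [h, T.depth_root] at hn; omega
    obtain ⟨e', he'⟩ := T.exists_outer _ h
    have := T.depth_outer e'
    rw [he'] at this
    exact ih e' (by omega)

/-! ### Heights and distances -/

/-- The height function, extended linearly to the points of the metric graph. -/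
def pointHeight : G.Point → ℝ
  | .vertex a => T.height a
  | .inner e t _ => T.height (G.init e) +
      t / G.len e * (T.height (G.term e) - T.height (G.init e))

lemma abs_height_sub (e : E) : |T.height (G.term e) - T.height (G.init e)| = G.len e := by
  have h := T.height_outer e
  have hp := G.len_pos e
  rcases T.joins e with ⟨h1, h2⟩ | ⟨h1, h2⟩
  · rw [h1, h2, h, add_sub_cancel_left, abs_of_pos hp]
  · rw [h1, h2, h, abs_sub_comm, add_sub_cancel_left, abs_of_pos hp]

lemma _root_.MetricGraph.pt_zero (e : E) : G.pt e 0 = .vertex (G.init e) := by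
  simp [pt]

lemma _root_.MetricGraph.pt_of_nonpos (e : E) {t : ℝ} (ht : t ≤ 0) :
    G.pt e t = .vertex (G.init e) := by
  simp [pt, ht, ht.not_gt]

lemma _root_.MetricGraph.pt_of_len_le (e : E) {t : ℝ} (ht : G.len e ≤ t) :
    G.pt e t = .vertex (G.term e) := by
  have := G.len_pos e
  simp [pt, ht.not_gt, (this.trans_le ht).not_ge]

lemma _root_.MetricGraph.pt_len (e : E) : G.pt e (G.len e) = .vertex (G.term e) :=
  pt_of_len_le e le_rfl

lemma _root_.MetricGraph.pt_of_mem (e : E) {t : ℝ} (ht : t ∈ Ioo 0 (G.len e)) :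
    G.pt e t = .inner e t ht := by
  simp only [pt, dif_pos ht]

lemma pointHeight_pt (e : E) {t : ℝ} (ht : t ∈ Icc 0 (G.len e)) :
    T.pointHeight (G.pt e t) = T.height (G.init e) +
      t / G.len e * (T.height (G.term e) - T.height (G.init e)) := by
  rcases ht.1.eq_or_lt with rfl | h0
  · simp [pt_zero, pointHeight]
  · rcases ht.2.eq_or_lt with rfl | h1
    · rw [pt_len, div_self (G.len_pos e).ne']; simp [pointHeight]
    · rw [pt_of_mem e ⟨h0, h1⟩]; rfl

/-- The height is affine with slope `±1` on every edge. Hence it is 1-Lipschitz along chains of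
points, which bounds distances in the metric graph from below. -/
lemma ofReal_abs_pointHeight_sub_le_edgeDist (p q : G.Point) :
    ENNReal.ofReal |T.pointHeight p - T.pointHeight q| ≤ G.edgeDist p q := by
  unfold edgeDist
  refine le_iInf fun e => le_iInf fun s => le_iInf fun hs => le_iInf fun t => le_iInf fun ht =>
    le_iInf fun h1 => le_iInf fun h2 => ?_
  rw [← h1, ← h2, T.pointHeight_pt e hs, T.pointHeight_pt e ht]
  apply ENNReal.ofReal_le_ofReal
  have hp := G.len_pos e
  have : T.height (G.init e) + s / G.len e * (T.height (G.term e) - T.height (G.init e)) -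
      (T.height (G.init e) + t / G.len e * (T.height (G.term e) - T.height (G.init e))) =
      (s - t) / G.len e * (T.height (G.term e) - T.height (G.init e)) := by ring
  rw [this, abs_mul, T.abs_height_sub, abs_div, abs_of_pos hp, div_mul_cancel₀ _ hp.ne']

lemma ofReal_abs_pointHeight_sub_le_pointDist (p q : G.Point) :
    ENNReal.ofReal |T.pointHeight p - T.pointHeight q| ≤ G.pointDist p q := by
  unfold pointDist
  refine le_iInf fun n => le_iInf fun x => le_iInf fun h1 => le_iInf fun h2 => ?_
  rw [← h1, ← h2]
  clear h1 h2
  induction n with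
  | zero => simp
  | succ n ih =>
    rw [Finset.sum_range_succ]
    calc _ ≤ ENNReal.ofReal (|T.pointHeight (x 0) - T.pointHeight (x n)| +
          |T.pointHeight (x n) - T.pointHeight (x (n + 1))|) :=
          ENNReal.ofReal_le_ofReal (abs_sub_le _ _ _)
      _ ≤ _ := by
          rw [ENNReal.ofReal_add (abs_nonneg _) (abs_nonneg _)]
          exact add_le_add ih (T.ofReal_abs_pointHeight_sub_le_edgeDist _ _)

lemma ofReal_height_le_pointDist (v : V) :
    ENNReal.ofReal (T.height v) ≤ G.pointDist (.vertex c) (.vertex v) := by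
  refine le_trans (ENNReal.ofReal_le_ofReal ?_) (T.ofReal_abs_pointHeight_sub_le_pointDist _ _)
  simp only [pointHeight, T.height_root, zero_sub, abs_neg]
  exact le_abs_self _

end Rooting

namespace Rooting

variable {c : V} (T : Rooting G c)

/-! ### Rays -/

/-- Inward steps lower the depth, so some step goes outward. Afterwards the ray cannot turn back:
the only edge leading inward from the current vertex is the one just used, and taking it would
repeat a vertex. -/
lemma ray_eventually_outward (r : G.Ray) :
    ∃ N, ∀ n, N ≤ n → r.vert n = T.inner (r.edge n) ∧ r.vert (n + 1) = T.outer (r.edge n) := by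
  have hj n := T.joins_iff.1 (r.joins n)
  have hstep : ∀ n, r.vert n = T.inner (r.edge n) ∧ r.vert (n + 1) = T.outer (r.edge n) →
      r.vert (n + 1) = T.inner (r.edge (n + 1)) ∧
        r.vert (n + 1 + 1) = T.outer (r.edge (n + 1)) := by
    intro n hn
    rcases hj (n + 1) with h | h
    · exact h
    · have h1 : r.edge (n + 1) = r.edge n := T.outer_injective (h.1.symm.trans hn.2)
      have h2 : r.vert (n + 1 + 1) = r.vert n := by rw [h.2, hn.1, h1]
      have := r.vert_injective h2
      omega
  have hex : ∃ N, r.vert N = T.inner (r.edge N) ∧ r.vert (N + 1) = T.outer (r.edge N) := by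
    by_contra! hne
    have hdec : ∀ n, T.depth (r.vert n) + n = T.depth (r.vert 0) := by
      intro n
      induction n with
      | zero => rfl
      | succ n ih =>
        rcases hj n with h | h
        · exact absurd h.2 (hne n h.1)
        · have := T.depth_outer (r.edge n)
          rw [h.1] at ih
          rw [h.2]
          omega
    have := hdec (T.depth (r.vert 0) + 1)
    omega
  obtain ⟨N, hN⟩ := hex
  refine ⟨N, fun n hn => ?_⟩
  induction n, hn using Nat.le_induction with
  | base => exact hN
  | succ n _ ih => exact hstep n ih

/-- Heights eventually increase along a ray, so a bound at arbitrarily late vertices holds at all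
late vertices. This lets height bounds pass between rays that merely share infinitely many vertices.
-/
lemma height_ray_le_of_frequently {r : G.Ray} {s : ℝ} (h : ∃ᶠ n in atTop, T.height (r.vert n) ≤ s) :
    ∀ᶠ n in atTop, T.height (r.vert n) ≤ s := by
  obtain ⟨N, hN⟩ := T.ray_eventually_outward r
  filter_upwards [eventually_ge_atTop N] with n hn
  obtain ⟨m, hm, hms⟩ := (Filter.frequently_atTop.1 h) n
  refine le_trans ?_ hms
  clear hms
  induction m, hm using Nat.le_induction with
  | base => exact le_rfl
  | succ m hm ih =>
    obtain ⟨h1, h2⟩ := hN m (hn.trans hm)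
    rw [h2, T.height_outer]
    rw [h1] at ih
    linarith [G.len_pos (r.edge m)]

lemma frequently_of_infinite_inter {r r' : G.Ray} (h : (range r.vert ∩ range r'.vert).Infinite)
    {p : V → Prop} (hp : ∀ᶠ n in atTop, p (r'.vert n)) : ∃ᶠ n in atTop, p (r.vert n) := by
  obtain ⟨N, hN⟩ := eventually_atTop.1 hp
  rw [frequently_atTop]
  intro a
  -- Discarding the finitely many early vertices of both rays leaves a common vertex that is late on
  -- each of them.
  have hfin : (r.vert '' Iio a ∪ r'.vert '' Iio N).Finite :=
    ((finite_Iio a).image _).union ((finite_Iio N).image _)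
  obtain ⟨v, ⟨⟨n, rfl⟩, ⟨m, hm⟩⟩, hv⟩ := (h.sdiff hfin).nonempty
  refine ⟨n, ?_, ?_⟩
  · by_contra hlt
    exact hv (Or.inl ⟨n, not_le.1 hlt, rfl⟩)
  · rw [← hm]
    apply hN
    by_contra hlt
    exact hv (Or.inr ⟨m, not_le.1 hlt, hm⟩)

lemma eventually_height_le_iff_of_infinite_inter {r r' : G.Ray}
    (h : (range r.vert ∩ range r'.vert).Infinite) (s : ℝ) :
    (∀ᶠ n in atTop, T.height (r.vert n) ≤ s) ↔ ∀ᶠ n in atTop, T.height (r'.vert n) ≤ s :=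
  ⟨fun h1 => T.height_ray_le_of_frequently
    (frequently_of_infinite_inter (p := fun v => T.height v ≤ s) (inter_comm _ _ ▸ h) h1),
  fun h1 => T.height_ray_le_of_frequently
    (frequently_of_infinite_inter (p := fun v => T.height v ≤ s) h h1)⟩

/-- An eventual height bound respects the generating relation, so it descends to the quotient and
depends only on the end. -/
lemma eventually_height_le_iff_of_toEnd_eq {r r' : G.Ray} (h : r.toEnd = r'.toEnd) (s : ℝ) :
    (∀ᶠ n in atTop, T.height (r.vert n) ≤ s) ↔ ∀ᶠ n in atTop, T.height (r'.vert n) ≤ s := by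
  let F : G.End → Prop := Quot.lift (fun r => ∀ᶠ n in atTop, T.height (r.vert n) ≤ s) (by
    rintro a b ⟨d, h1, h2⟩
    exact propext ((T.eventually_height_le_iff_of_infinite_inter h1 s).trans
      (T.eventually_height_le_iff_of_infinite_inter h2 s).symm))
  exact iff_of_eq (congrArg F h)

lemma height_vert_le_add_sum (r : G.Ray) (n : ℕ) :
    T.height (r.vert n) ≤ T.height (r.vert 0) + ∑ i ∈ Finset.range n, G.len (r.edge i) := by
  induction n with
  | zero => simp
  | succ n ih =>
    rw [Finset.sum_range_succ]
    have hp := G.len_pos (r.edge n)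
    have ho := T.height_outer (r.edge n)
    rcases T.joins_iff.1 (r.joins n) with ⟨h1, h2⟩ | ⟨h1, h2⟩
    · rw [h2, ho]; rw [h1] at ih; linarith
    · rw [h2]; rw [h1] at ih; linarith

/-- A ray of the same end nearly realizing the distance has all its heights below `s`. The bound is
then transferred to `r`, whose early vertices may be higher. -/
lemma eventually_height_le_of_endDist_lt {r : G.Ray} {s : ℝ}
    (h : G.endDist (.vertex c) r.toEnd < ENNReal.ofReal s) :
    ∀ᶠ n in atTop, T.height (r.vert n) ≤ s := by
  unfold endDist at h
  simp only [iInf_lt_iff] at h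
  obtain ⟨r', hr', h⟩ := h
  rw [← T.eventually_height_le_iff_of_toEnd_eq hr']
  refine Eventually.of_forall fun n => ?_
  have hs : 0 < s := by
    by_contra hs
    rw [ENNReal.ofReal_of_nonpos (not_lt.1 hs)] at h
    exact not_lt_zero h
  rw [← ENNReal.ofReal_le_ofReal_iff hs.le]
  refine le_trans ?_ h.le
  calc ENNReal.ofReal (T.height (r'.vert n))
      ≤ ENNReal.ofReal (T.height (r'.vert 0) + ∑ i ∈ Finset.range n, G.len (r'.edge i)) :=
        ENNReal.ofReal_le_ofReal (T.height_vert_le_add_sum r' n)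
    _ = ENNReal.ofReal (T.height (r'.vert 0)) +
        ∑ i ∈ Finset.range n, ENNReal.ofReal (G.len (r'.edge i)) := by
        rw [ENNReal.ofReal_add (T.height_nonneg _)
          (Finset.sum_nonneg fun i _ => (G.len_pos _).le),
          ENNReal.ofReal_sum_of_nonneg fun i _ => (G.len_pos _).le]
    _ ≤ _ := add_le_add (T.ofReal_height_le_pointDist _) (ENNReal.sum_le_tsum _)

/-- A sequence of consecutive edges leading away from the root is a ray. -/
def outwardRay (e : ℕ → E) (he : ∀ n, T.inner (e (n + 1)) = T.outer (e n)) : G.Ray where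
  vert n := T.inner (e n)
  edge := e
  vert_injective := by
    have h : ∀ n, T.depth (T.inner (e n)) = T.depth (T.inner (e 0)) + n := by
      intro n
      induction n with
      | zero => rfl
      | succ n ih => rw [he, T.depth_outer, ih, add_assoc]
    intro n m hnm
    have := congrArg T.depth hnm
    rw [h n, h m] at this
    omega
  joins n := by rw [he]; exact T.joins _

lemma height_inner_monotone (e : ℕ → E) (he : ∀ n, T.inner (e (n + 1)) = T.outer (e n)) :
    Monotone fun n => T.height (T.inner (e n)) :=
  monotone_nat_of_le_succ fun n => by rw [he]; exact (T.height_inner_lt _).le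

lemma height_le_of_endDist_le {R : ℝ} (e : ℕ → E)
    (he : ∀ n, T.inner (e (n + 1)) = T.outer (e n))
    (h : G.endDist (.vertex c) (T.outwardRay e he).toEnd ≤ ENNReal.ofReal R) (hR : 0 ≤ R) (n : ℕ) :
    T.height (T.inner (e n)) ≤ R := by
  refine le_of_forall_gt_imp_ge_of_dense fun s hs => ?_
  have h1 : G.endDist (.vertex c) (T.outwardRay e he).toEnd < ENNReal.ofReal s :=
    h.trans_lt ((ENNReal.ofReal_lt_ofReal_iff (hR.trans_lt hs)).2 hs)
  obtain ⟨N, hN⟩ := eventually_atTop.1 (T.eventually_height_le_of_endDist_lt h1)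
  exact (T.height_inner_monotone e he (le_max_left n N)).trans (hN _ (le_max_right n N))

/-- For an outward ray starting at the root, the partial sums of the edge lengths are exactly the
heights of its vertices. -/
lemma endDist_outwardRay_le {s : ℝ} (e : ℕ → E)
    (he : ∀ n, T.inner (e (n + 1)) = T.outer (e n)) (h0 : T.inner (e 0) = c)
    (h : ∀ n, T.height (T.inner (e n)) ≤ s) :
    G.endDist (.vertex c) (T.outwardRay e he).toEnd ≤ ENNReal.ofReal s := by
  unfold endDist
  refine iInf₂_le_of_le (T.outwardRay e he) rfl ?_
  have h1 : G.pointDist (.vertex c) (.vertex ((T.outwardRay e he).vert 0)) = 0 := by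
    refine le_antisymm ?_ bot_le
    unfold pointDist
    refine iInf₂_le_of_le 0 (fun _ => .vertex c) (iInf₂_le_of_le rfl ?_ (by simp))
    change Point.vertex c = Point.vertex (T.inner (e 0))
    rw [h0]
  rw [h1, zero_add]
  unfold Ray.length
  refine ENNReal.tsum_le_of_sum_range_le fun n => ?_
  rw [← ENNReal.ofReal_sum_of_nonneg fun i _ => (G.len_pos _).le]
  apply ENNReal.ofReal_le_ofReal
  refine le_trans (le_of_eq ?_) (h n)
  change ∑ i ∈ Finset.range n, G.len (e i) = _
  induction n with
  | zero => simp [h0, T.height_root]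
  | succ n ih => rw [Finset.sum_range_succ, ih, he, T.height_outer]

/-! ### Chains of edges -/

/-- A choice of a continuation of every edge away from the root, whenever its outer vertex does not
have degree one. -/
structure Continuation where
  succ : E → Option E
  inner_of_succ : ∀ e e', succ e = some e' → T.inner e' = T.outer e
  degree_of_succ : ∀ e, succ e = none → G.degree (T.outer e) = 1

lemma exists_continuation : Nonempty T.Continuation := by
  classical
  have h : ∀ e, ∃ o : Option E, (∀ e', o = some e' → T.inner e' = T.outer e) ∧
      (o = none → G.degree (T.outer e) = 1) := by
    intro e
    by_cases hd : G.degree (T.outer e) = 1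
    · exact ⟨none, by simp, fun _ => hd⟩
    · obtain ⟨e', he'⟩ := T.exists_inner_of_degree_ne_one (T.outer_ne_root e) hd
      exact ⟨some e', by simp [he'], by simp⟩
  choose f hf1 hf2 using h
  exact ⟨⟨f, hf1, hf2⟩⟩

variable {T}

namespace Continuation

variable (K : T.Continuation)

lemma succ_injective {e e' a : E} (h : K.succ e = some a) (h' : K.succ e' = some a) : e = e' :=
  T.outer_injective ((K.inner_of_succ _ _ h).symm.trans (K.inner_of_succ _ _ h'))

/-- The chain of edges starting with a given edge. -/
def chain (e : E) : ℕ → Option E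
  | 0 => some e
  | n + 1 => (chain e n).bind K.succ

lemma exists_of_chain_succ {e e' : E} {n : ℕ} (h : K.chain e (n + 1) = some e') :
    ∃ a, K.chain e n = some a ∧ K.succ a = some e' := by
  simpa [chain, Option.bind_eq_some_iff] using h

/-- A chain either ends at a vertex of degree one, or forms a ray. -/
lemma chain_cases (e : E) :
    (∃ n a, K.chain e n = some a ∧ K.succ a = none) ∨
      ∃ a : ℕ → E, a 0 = e ∧ (∀ n, K.chain e n = some (a n)) ∧
        ∀ n, T.inner (a (n + 1)) = T.outer (a n) := by
  by_cases h : ∀ n, ∃ a, K.chain e n = some a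
  · right
    choose a ha using h
    refine ⟨a, by simpa [chain] using (ha 0).symm, ha, fun n => ?_⟩
    obtain ⟨b, hb, hb'⟩ := K.exists_of_chain_succ (ha (n + 1))
    rw [ha n, Option.some.injEq] at hb
    exact K.inner_of_succ _ _ (hb ▸ hb')
  · left
    push Not at h
    obtain ⟨n, hn⟩ := h
    induction n with
    | zero => exact absurd rfl (hn e)
    | succ n ih =>
      by_cases h0 : ∃ a, K.chain e n = some a
      · obtain ⟨a, ha⟩ := h0
        refine ⟨n, a, ha, ?_⟩
        by_contra hne
        obtain ⟨b, hb⟩ := Option.ne_none_iff_exists'.1 hne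
        exact hn b (by simp [chain, ha, hb])
      · push Not at h0
        exact ih h0

lemma height_le_of_mem_chain {e a : E} {n : ℕ} (h : K.chain e n = some a) :
    T.height (T.inner e) ≤ T.height (T.inner a) := by
  induction n generalizing a with
  | zero => simp only [chain, Option.some.injEq] at h; rw [h]
  | succ n ih =>
    obtain ⟨b, hb, hb'⟩ := K.exists_of_chain_succ h
    rw [K.inner_of_succ _ _ hb']
    exact (ih hb).trans (T.height_inner_lt b).le

end Continuation

/-! ### Trees with a centre -/

variable (T)

lemma leaf_mem_dirichletSet (e : E) (h : G.degree (T.outer e) = 1) :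
    (Sum.inl (.vertex (T.outer e)) : G.Closure) ∈ G.dirichletSet c :=
  Or.inr ⟨_, T.outer_ne_root e, h, rfl⟩

lemma _root_.MetricGraph.end_mem_dirichletSet (γ : G.End) :
    (Sum.inr γ : G.Closure) ∈ G.dirichletSet c :=
  Or.inl ⟨γ, rfl⟩

/-- Following continuations outward from any edge produces a leaf or an end. -/
lemma dirichletSet_nonempty [Nonempty E] (T : Rooting G c) : (G.dirichletSet c).Nonempty := by
  obtain ⟨K⟩ := T.exists_continuation
  obtain ⟨e⟩ := ‹Nonempty E›
  rcases K.chain_cases e with ⟨n, a, -, ha⟩ | ⟨a, -, -, ha⟩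
  · exact ⟨_, T.leaf_mem_dirichletSet a (K.degree_of_succ a ha)⟩
  · exact ⟨_, end_mem_dirichletSet (T.outwardRay a ha).toEnd⟩

/-- Heights increase along the chain that starts with `e`, and this chain leads to a leaf or an end
at distance `R` from the root. -/
lemma height_outer_le {R : ℝ}
    (hR : ∀ x ∈ G.dirichletSet c, G.closureDist (.inl (.vertex c)) x = ENNReal.ofReal R)
    (h0 : 0 ≤ R) (e : E) : T.height (T.outer e) ≤ R := by
  obtain ⟨K⟩ := T.exists_continuation
  rcases K.chain_cases e with ⟨n, a, hn, ha⟩ | ⟨a, rfl, -, ha⟩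
  · have h1 : T.height (T.outer a) ≤ R := by
      have h2 := hR _ (T.leaf_mem_dirichletSet a (K.degree_of_succ a ha))
      rw [← ENNReal.ofReal_le_ofReal_iff h0, ← h2]
      exact T.ofReal_height_le_pointDist _
    rcases n with _ | n
    · simp only [Continuation.chain, Option.some.injEq] at hn; rwa [hn]
    · refine le_trans ?_ h1
      refine le_trans ?_ (T.height_inner_lt a).le
      clear h1 ha
      induction n generalizing a with
      | zero =>
        obtain ⟨b, hb, hb'⟩ := K.exists_of_chain_succ hn
        simp only [Continuation.chain, Option.some.injEq] at hb
        rw [K.inner_of_succ _ _ hb', hb]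
      | succ n ih =>
        obtain ⟨b, hb, hb'⟩ := K.exists_of_chain_succ hn
        rw [K.inner_of_succ _ _ hb']
        exact (ih _ hb).trans (T.height_inner_lt b).le
  · have := T.height_le_of_endDist_le a ha (hR _ (end_mem_dirichletSet _)).le h0 1
    rwa [ha] at this

/-- This is König's lemma: infinitely many vertices of height at most `s` would produce an outward
ray from the root staying below `s`, whose end is closer to the root than `R`. -/
lemma finite_height_le {R : ℝ}
    (hR : ∀ x ∈ G.dirichletSet c, G.closureDist (.inl (.vertex c)) x = ENNReal.ofReal R)
    (hfin : G.LocallyFinite) {s : ℝ} (hs : s < R) :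
    {v | T.height v ≤ s}.Finite := by
  by_contra hinf
  let Anc : V → V → Prop := Relation.ReflTransGen fun a b => ∃ e, T.inner e = a ∧ T.outer e = b
  let D : V → Set V := fun v => {w | Anc v w ∧ T.height w ≤ s}
  have hroot : ∀ v, Anc c v := by
    intro v
    induction hn : T.depth v using Nat.strong_induction_on generalizing v with
    | _ n ih =>
      by_cases hv : v = c
      · exact hv ▸ Relation.ReflTransGen.refl
      · obtain ⟨e, rfl⟩ := T.exists_outer v hv
        exact (ih _ (by have := T.depth_outer e; omega) (T.inner e) rfl).tail ⟨e, rfl, rfl⟩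
  have hle : ∀ v w, Anc v w → T.height v ≤ T.height w := by
    intro v w h
    induction h with
    | refl => exact le_rfl
    | tail _ h ih =>
      obtain ⟨e, rfl, rfl⟩ := h
      exact ih.trans (T.height_inner_lt e).le
  -- Since the degrees are finite, some child of a vertex with infinitely many low descendants
  -- inherits this property.
  have hstep : ∀ v, (D v).Infinite → ∃ e, T.inner e = v ∧ (D (T.outer e)).Infinite := by
    intro v hv
    by_contra! hne
    refine hv (((finite_singleton v).union ((T.finite_incident hfin v).biUnion
      (t := fun e => D (T.outer e)) ?_)).subset ?_)
    · intro e he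
      exact hne e he
    · rintro w ⟨hw, hws⟩
      rcases Relation.ReflTransGen.cases_head hw with rfl | ⟨b, ⟨e, rfl, rfl⟩, hb⟩
      · exact Or.inl rfl
      · exact Or.inr (mem_biUnion (show e ∈ {e' | T.inner e' = T.inner e} from rfl) ⟨hb, hws⟩)
  have hD : (D c).Infinite := fun h => hinf (h.subset fun v hv => ⟨hroot v, hv⟩)
  have : Nonempty E := ⟨(hstep c hD).choose⟩
  choose! f hf1 hf2 using hstep
  let x : ℕ → V := fun n => n.rec c fun _ v => T.outer (f v)
  have hx : ∀ n, (D (x n)).Infinite := by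
    intro n
    induction n with
    | zero => exact hD
    | succ n ih => exact hf2 _ ih
  let a : ℕ → E := fun n => f (x n)
  have ha : ∀ n, T.inner (a n) = x n := fun n => hf1 _ (hx n)
  have hb : ∀ n, T.inner (a (n + 1)) = T.outer (a n) := fun n => ha (n + 1)
  have h1 := T.endDist_outwardRay_le a hb (ha 0) (s := s) (fun n => by
    rw [ha n]
    obtain ⟨w, hw, hws⟩ := (hx n).nonempty
    exact (hle _ _ hw).trans hws)
  have h2 := hR _ (end_mem_dirichletSet (T.outwardRay a hb).toEnd)
  change G.endDist _ _ = _ at h2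
  rw [h2] at h1
  have h3 : 0 ≤ s := by
    obtain ⟨w, -, hws⟩ := (hx 0).nonempty
    exact (T.height_nonneg w).trans hws
  rw [ENNReal.ofReal_le_ofReal_iff h3] at h1
  linarith

lemma finite_height_inner_le {R : ℝ}
    (hR : ∀ x ∈ G.dirichletSet c, G.closureDist (.inl (.vertex c)) x = ENNReal.ofReal R)
    (hfin : G.LocallyFinite) {s : ℝ} (hs : s < R) :
    {e | T.height (T.inner e) ≤ s}.Finite := by
  refine ((T.finite_height_le hR hfin hs).biUnion
    (t := fun v => {e | T.inner e = v}) fun v _ => T.finite_incident hfin v).subset ?_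
  intro e he
  exact mem_biUnion (show T.inner e ∈ {v | T.height v ≤ s} from he) rfl

end Rooting

/-! ### Absolutely continuous functions on an interval -/

lemma _root_.AbsolutelyContinuousOnInterval.intervalIntegrable_sq {g : ℝ → ℝ} {a b : ℝ}
    (hg : AbsolutelyContinuousOnInterval g a b) :
    IntervalIntegrable (fun t => g t ^ 2) volume a b :=
  (hg.continuousOn.pow 2).intervalIntegrable

/-- Picone's inequality for a solution `W` of the Riccati equation `W' = μ + W ^ 2`. -/
lemma picone_le {g W : ℝ → ℝ} {ℓ μ : ℝ} (hℓ : 0 ≤ ℓ)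
    (hg : AbsolutelyContinuousOnInterval g 0 ℓ)
    (hg' : IntervalIntegrable (fun t => deriv g t ^ 2) volume 0 ℓ)
    (hW : ∀ t ∈ Icc 0 ℓ, HasDerivAt W (μ + W t ^ 2) t) :
    g 0 ^ 2 * W 0 + μ * ∫ t in (0)..ℓ, g t ^ 2 ≤
      (∫ t in (0)..ℓ, deriv g t ^ 2) + g ℓ ^ 2 * W ℓ := by
  have hu : uIcc 0 ℓ = Icc 0 ℓ := uIcc_of_le hℓ
  have hWc : ContinuousOn W (Icc 0 ℓ) := fun t ht => (hW t ht).continuousAt.continuousWithinAt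
  have hWac : AbsolutelyContinuousOnInterval W 0 ℓ := by
    obtain ⟨C, hC⟩ := isCompact_Icc.exists_bound_of_continuousOn
      (f := fun t => μ + W t ^ 2) (s := Icc 0 ℓ) (by fun_prop)
    refine LipschitzOnWith.absolutelyContinuousOnInterval (K := C.toNNReal) ?_
    rw [hu]
    refine (convex_Icc 0 ℓ).lipschitzOnWith_of_nnnorm_hasDerivWithin_le
      (fun t ht => (hW t ht).hasDerivWithinAt) fun t ht => ?_
    rw [← NNReal.coe_le_coe]
    exact (hC t ht).trans (Real.le_coe_toNNReal C)
  have hF : AbsolutelyContinuousOnInterval (g * g * W) 0 ℓ := (hg.mul hg).mul hWac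
  have hint := hF.integral_deriv_eq_sub
  have h1 : IntervalIntegrable (fun t => deriv g t ^ 2 + deriv (g * g * W) t - μ * g t ^ 2)
      volume 0 ℓ :=
    (hg'.add hF.intervalIntegrable_deriv).sub (hg.intervalIntegrable_sq.const_mul μ)
  have h2 : 0 ≤ ∫ t in (0)..ℓ, (deriv g t ^ 2 + deriv (g * g * W) t - μ * g t ^ 2) := by
    refine intervalIntegral.integral_nonneg_of_ae_restrict hℓ ?_
    rw [Filter.EventuallyLE, ae_restrict_iff' measurableSet_Icc]
    filter_upwards [hg.ae_differentiableAt] with t ht htI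
    have hd := (ht (hu ▸ htI)).hasDerivAt
    have := ((hd.mul hd).mul (hW t htI)).deriv
    rw [this]
    -- Picone's identity: the Riccati equation completes the square.
    have : deriv g t ^ 2 + ((deriv g t * g t + g t * deriv g t) * W t + (g * g) t * (μ + W t ^ 2)) -
      μ * g t ^ 2 = (deriv g t + W t * g t) ^ 2 := by simp only [Pi.mul_apply]; ring
    simp only [Pi.zero_apply]
    rw [this]
    positivity
  rw [intervalIntegral.integral_sub (hg'.add hF.intervalIntegrable_deriv)
    (hg.intervalIntegrable_sq.const_mul μ), intervalIntegral.integral_add hg'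
    hF.intervalIntegrable_deriv, hint, intervalIntegral.integral_const_mul] at h2
  simp only [Pi.mul_apply] at h2
  nlinarith [h2]

/-- This is the Cauchy–Schwarz inequality, obtained by expanding the nonnegative integral of the
squared deviation of `v` from its mean. -/
lemma sq_integral_le_mul_integral {v : ℝ → ℝ} {a b s t : ℝ} (hv : IntervalIntegrable v volume a b)
    (hv2 : IntervalIntegrable (fun t => v t ^ 2) volume a b)
    (has : a ≤ s) (hst : s ≤ t) (htb : t ≤ b) :
    (∫ x in s..t, v x) ^ 2 ≤ (t - s) * ∫ x in a..b, v x ^ 2 := by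
  have hsub : uIcc s t ⊆ uIcc a b := by
    rw [uIcc_of_le hst, uIcc_of_le (has.trans (hst.trans htb))]
    exact Icc_subset_Icc has htb
  have hvst := hv.mono_set hsub
  have hv2st := hv2.mono_set hsub
  have hle : ∫ x in s..t, v x ^ 2 ≤ ∫ x in a..b, v x ^ 2 :=
    intervalIntegral.integral_mono_interval has hst htb
      (Eventually.of_forall fun x => sq_nonneg (v x)) hv2
  refine le_trans ?_ (mul_le_mul_of_nonneg_left hle (sub_nonneg.2 hst))
  rcases hst.eq_or_lt with rfl | hlt
  · simp
  have hp : 0 < t - s := sub_pos.2 hlt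
  set m := (∫ x in s..t, v x) / (t - s) with hm
  have h0 : 0 ≤ ∫ x in s..t, (v x - m) ^ 2 :=
    intervalIntegral.integral_nonneg hst fun x _ => sq_nonneg _
  have h1 : ∫ x in s..t, (v x - m) ^ 2 =
      (∫ x in s..t, v x ^ 2) - 2 * m * (∫ x in s..t, v x) + m ^ 2 * (t - s) := by
    have : ∀ x, (v x - m) ^ 2 = v x ^ 2 - 2 * m * v x + m ^ 2 := fun x => by ring
    simp only [this]
    rw [intervalIntegral.integral_add (hv2st.sub (hvst.const_mul _))
      intervalIntegrable_const, intervalIntegral.integral_sub hv2st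
      (hvst.const_mul _), intervalIntegral.integral_const_mul,
      intervalIntegral.integral_const, smul_eq_mul]
    ring
  have hms : m * (t - s) = ∫ x in s..t, v x := div_mul_cancel₀ _ hp.ne'
  rw [h1, ← hms] at h0
  rw [← hms]
  nlinarith [h0]

lemma sq_sub_le_mul_integral {g : ℝ → ℝ} {a b s t : ℝ}
    (hg : AbsolutelyContinuousOnInterval g a b)
    (hg' : IntervalIntegrable (fun t => deriv g t ^ 2) volume a b)
    (has : a ≤ s) (hst : s ≤ t) (htb : t ≤ b) :
    (g t - g s) ^ 2 ≤ (t - s) * ∫ x in a..b, deriv g x ^ 2 := by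
  have hsub : uIcc s t ⊆ uIcc a b := by
    rw [uIcc_of_le hst, uIcc_of_le (has.trans (hst.trans htb))]
    exact Icc_subset_Icc has htb
  rw [← (hg.mono hsub).integral_deriv_eq_sub]
  exact sq_integral_le_mul_integral hg.intervalIntegrable_deriv hg' has hst htb

/-- On each of the `N` pieces, `g t ^ 2` is at most twice the square of the sampled value plus twice
the squared oscillation, and the latter is at most the piece length times the energy. The energy
term becomes small as `N` grows, which is the local source of compactness. -/
lemma integral_sq_le_sum_sample {g : ℝ → ℝ} {ℓ : ℝ} (hℓ : 0 < ℓ)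
    (hg : AbsolutelyContinuousOnInterval g 0 ℓ)
    (hg' : IntervalIntegrable (fun t => deriv g t ^ 2) volume 0 ℓ) {N : ℕ} (hN : 0 < N) :
    ∫ t in (0)..ℓ, g t ^ 2 ≤ 2 * (ℓ / N) * ∑ k ∈ Finset.range N, g (k * (ℓ / N)) ^ 2 +
      2 * (ℓ / N) * ℓ * ∫ t in (0)..ℓ, deriv g t ^ 2 := by
  set δ := ℓ / N with hδ
  set I := ∫ t in (0)..ℓ, deriv g t ^ 2
  have hN' : (0 : ℝ) < N := by exact_mod_cast hN
  have hδ0 : 0 < δ := div_pos hℓ hN'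
  have hNδ : N * δ = ℓ := by rw [hδ]; field_simp
  have hmem : ∀ k : ℕ, k < N → 0 ≤ k * δ ∧ ((k + 1 : ℕ) : ℝ) * δ ≤ ℓ := by
    intro k hk
    refine ⟨by positivity, ?_⟩
    rw [← hNδ]
    gcongr
    exact hk
  have hint : ∀ k : ℕ, k < N → IntervalIntegrable (fun t => g t ^ 2) volume (k * δ)
      ((k + 1 : ℕ) * δ) := by
    intro k hk
    obtain ⟨h1, h2⟩ := hmem k hk
    refine hg.intervalIntegrable_sq.mono_set ?_
    have h3 : (k : ℝ) * δ ≤ ((k + 1 : ℕ) : ℝ) * δ := by gcongr; simp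
    rw [uIcc_of_le h3, uIcc_of_le hℓ.le]
    exact Icc_subset_Icc h1 h2
  have hsum := intervalIntegral.sum_integral_adjacent_intervals (a := fun k : ℕ => (k : ℝ) * δ) hint
  simp only [Nat.cast_zero, zero_mul, hNδ] at hsum
  rw [← hsum]
  have hk : ∀ k ∈ Finset.range N, ∫ t in ((k : ℝ) * δ)..((k + 1 : ℕ) * δ), g t ^ 2 ≤
      2 * δ * g (k * δ) ^ 2 + 2 * δ * δ * I := by
    intro k hk
    obtain ⟨h1, h2⟩ := hmem k (Finset.mem_range.1 hk)
    have h3 : (k : ℝ) * δ ≤ ((k + 1 : ℕ) : ℝ) * δ := by gcongr; simp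
    have h4 : ∫ t in ((k : ℝ) * δ)..((k + 1 : ℕ) * δ), (2 * g (k * δ) ^ 2 + 2 * δ * I) =
        2 * δ * g (k * δ) ^ 2 + 2 * δ * δ * I := by
      rw [intervalIntegral.integral_const, smul_eq_mul]
      push_cast
      ring
    rw [← h4]
    refine intervalIntegral.integral_mono_on h3 (hint k (Finset.mem_range.1 hk))
      intervalIntegrable_const fun t ht => ?_
    have h5 := sq_sub_le_mul_integral hg hg' h1 ht.1 (ht.2.trans h2)
    have h6 : t - k * δ ≤ δ := by have := ht.2; push_cast at this; linarith
    have hI : 0 ≤ I := intervalIntegral.integral_nonneg hℓ.le fun x _ => sq_nonneg _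
    have h7 := mul_le_mul_of_nonneg_right h6 hI
    nlinarith [sq_nonneg (g t - 2 * g (k * δ))]
  refine (Finset.sum_le_sum hk).trans (le_of_eq ?_)
  rw [Finset.sum_add_distrib, ← Finset.mul_sum, Finset.sum_const, Finset.card_range, nsmul_eq_mul]
  have : (N : ℝ) * (2 * δ * δ * I) = 2 * δ * (N * δ) * I := by ring
  rw [this, hNδ]

/-- The solution `κ tan (κ (x - x₀))` of the Riccati equation. -/
lemma hasDerivAt_mul_tan {κ x₀ x : ℝ} (h : Real.cos (κ * (x - x₀)) ≠ 0) :
    HasDerivAt (fun y => κ * Real.tan (κ * (y - x₀)))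
      (κ ^ 2 + (κ * Real.tan (κ * (x - x₀))) ^ 2) x := by
  have h1 : HasDerivAt (fun y => κ * (y - x₀)) κ x := by
    simpa using ((hasDerivAt_id x).sub_const x₀).const_mul κ
  have h2 := ((Real.hasDerivAt_tan h).comp x h1).const_mul κ
  refine h2.congr_deriv ?_
  rw [Real.tan_eq_sin_div_cos]
  field_simp
  rw [Real.cos_sq_add_sin_sq, mul_one]

/-! ### Integration on the metric graph -/

lemma measurable_pt (e : E) : Measurable (G.pt e) :=
  measurable_iff_le_map.2 (iInf_le _ e)

lemma measurable_of_measurable_comp_pt {F : G.Point → ℝ} (h : ∀ e, Measurable fun t => F (G.pt e t)) :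
    Measurable F := by
  intro s hs
  change MeasurableSet[⨅ e, (inferInstance : MeasurableSpace ℝ).map (G.pt e)] _
  rw [MeasurableSpace.measurableSet_iInf]
  exact fun e => h e hs

lemma ae_vol_iff [Countable E] {P : G.Point → Prop} (hP : MeasurableSet {p | P p}) :
    (∀ᵐ p ∂G.vol, P p) ↔ ∀ e, ∀ᵐ t, t ∈ Ioo 0 (G.len e) → P (G.pt e t) := by
  unfold vol
  rw [Measure.ae_sum_iff]
  refine forall_congr' fun e => ?_
  rw [ae_map_iff (measurable_pt e).aemeasurable hP, Measure.restrict_congr_set Ioo_ae_eq_Icc.symm,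
    ae_restrict_iff' measurableSet_Ioo]

lemma integrable_map_pt_iff {F : G.Point → ℝ} (hF : Measurable F) (e : E) :
    Integrable F ((volume.restrict (Icc 0 (G.len e))).map (G.pt e)) ↔
      IntervalIntegrable (fun t => F (G.pt e t)) volume 0 (G.len e) := by
  rw [integrable_map_measure hF.aestronglyMeasurable (measurable_pt e).aemeasurable,
    intervalIntegrable_iff_integrableOn_Icc_of_le (G.len_pos e).le]
  rfl

lemma integral_map_pt {F : G.Point → ℝ} (hF : Measurable F) (e : E) :
    ∫ p, F p ∂((volume.restrict (Icc 0 (G.len e))).map (G.pt e)) =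
      ∫ t in (0)..(G.len e), F (G.pt e t) := by
  rw [integral_map (measurable_pt e).aemeasurable hF.aestronglyMeasurable,
    intervalIntegral.integral_of_le (G.len_pos e).le, integral_Icc_eq_integral_Ioc]

lemma intervalIntegrable_of_integrable {F : G.Point → ℝ} (hF : Measurable F)
    (h : Integrable F G.vol) (e : E) :
    IntervalIntegrable (fun t => F (G.pt e t)) volume 0 (G.len e) :=
  (integrable_map_pt_iff hF e).1 (h.mono_measure (Measure.le_sum _ e))

lemma hasSum_integral_vol {F : G.Point → ℝ} (hF : Measurable F) (h : Integrable F G.vol) :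
    HasSum (fun e => ∫ t in (0)..(G.len e), F (G.pt e t)) (∫ p, F p ∂G.vol) := by
  have := hasSum_integral_measure (μ := fun e => (volume.restrict (Icc 0 (G.len e))).map (G.pt e)) h
  simp only [integral_map_pt hF] at this
  exact this

lemma integrable_vol_of_summable [Countable E] {F : G.Point → ℝ} (hF : Measurable F)
    (h0 : ∀ p, 0 ≤ F p)
    (h : ∀ e, IntervalIntegrable (fun t => F (G.pt e t)) volume 0 (G.len e))
    (hs : Summable fun e => ∫ t in (0)..(G.len e), F (G.pt e t)) : Integrable F G.vol := by
  refine integrable_sum_measure (fun e => (integrable_map_pt_iff hF e).2 (h e)) ?_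
  simpa only [Real.norm_of_nonneg (h0 _), integral_map_pt hF] using hs

/-! ### Functions that are absolutely continuous on the edges -/

/-- The derivative of a function along an edge. -/
def derivOn (f : G.Point → ℝ) (e : E) (t : ℝ) : ℝ := deriv (fun s => f (G.pt e s)) t

/-- The integral of `f ^ 2` over an edge. -/
def mass (f : G.Point → ℝ) (e : E) : ℝ := ∫ t in (0)..(G.len e), f (G.pt e t) ^ 2

/-- The integral of `f' ^ 2` over an edge. -/
def energy (f : G.Point → ℝ) (e : E) : ℝ := ∫ t in (0)..(G.len e), derivOn f e t ^ 2

lemma mass_nonneg (f : G.Point → ℝ) (e : E) : 0 ≤ mass f e :=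
  intervalIntegral.integral_nonneg (G.len_pos e).le fun _ _ => sq_nonneg _

lemma energy_nonneg (f : G.Point → ℝ) (e : E) : 0 ≤ energy f e :=
  intervalIntegral.integral_nonneg (G.len_pos e).le fun _ _ => sq_nonneg _

lemma edgeDeriv_pt (f : G.Point → ℝ) (e : E) (t : ℝ) :
    edgeDeriv f (G.pt e t) = (Ioo 0 (G.len e)).indicator (derivOn f e) t := by
  by_cases ht : t ∈ Ioo 0 (G.len e)
  · rw [indicator_of_mem ht, pt_of_mem e ht]; rfl
  · rw [indicator_of_notMem ht]
    rcases le_or_gt t 0 with h | h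
    · rw [pt_of_nonpos e h]; rfl
    · have : G.len e ≤ t := by
        by_contra h'
        exact ht ⟨h, not_le.1 h'⟩
      rw [pt_of_len_le e this]; rfl

lemma edgeDeriv_pt_of_mem (f : G.Point → ℝ) (e : E) {t : ℝ} (ht : t ∈ Ioo 0 (G.len e)) :
    edgeDeriv f (G.pt e t) = derivOn f e t := by
  rw [edgeDeriv_pt, indicator_of_mem ht]

lemma measurable_edgeDeriv (f : G.Point → ℝ) : Measurable (edgeDeriv f) := by
  refine measurable_of_measurable_comp_pt fun e => ?_
  simp only [edgeDeriv_pt]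
  exact (measurable_deriv _).indicator measurableSet_Ioo

lemma intervalIntegral_congr_Ioo {a b : ℝ} (hab : a ≤ b) {φ ψ : ℝ → ℝ}
    (h : ∀ t ∈ Ioo a b, φ t = ψ t) : ∫ t in a..b, φ t = ∫ t in a..b, ψ t := by
  rw [intervalIntegral.integral_of_le hab, intervalIntegral.integral_of_le hab,
    integral_Ioc_eq_integral_Ioo, integral_Ioc_eq_integral_Ioo]
  exact setIntegral_congr_fun measurableSet_Ioo h

lemma intervalIntegrable_congr_Ioo {a b : ℝ} (hab : a ≤ b) {φ ψ : ℝ → ℝ}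
    (h : ∀ t ∈ Ioo a b, φ t = ψ t) :
    IntervalIntegrable φ volume a b ↔ IntervalIntegrable ψ volume a b := by
  rw [intervalIntegrable_iff_integrableOn_Ioo_of_le hab,
    intervalIntegrable_iff_integrableOn_Ioo_of_le hab]
  exact integrableOn_congr_fun h measurableSet_Ioo

/-- Along an edge, `f` is the constant extension of a continuous function on a compact interval,
hence continuous on the real line. -/
lemma measurable_of_absCont {f : G.Point → ℝ}
    (h : ∀ e, AbsolutelyContinuousOnInterval (fun s => f (G.pt e s)) 0 (G.len e)) :
    Measurable f := by
  refine measurable_of_measurable_comp_pt fun e => ?_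
  have hp := (G.len_pos e).le
  have hc := (h e).continuousOn
  rw [uIcc_of_le hp] at hc
  have h1 : (fun t => f (G.pt e t)) =
      IccExtend hp (domRestrict (Icc 0 (G.len e)) fun s => f (G.pt e s)) := by
    ext t
    rcases le_total t 0 with h | h
    · rw [IccExtend_of_le_left hp _ h, pt_of_nonpos e h, domRestrict_apply, pt_zero]
    · rcases le_total (G.len e) t with h' | h'
      · rw [IccExtend_of_right_le hp _ h', pt_of_len_le e h', domRestrict_apply, pt_len]
      · rw [IccExtend_of_mem hp _ ⟨h, h'⟩]
        rfl
  rw [h1]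
  exact (continuous_IccExtend_iff.2 hc.domRestrict).measurable

lemma _root_.AbsolutelyContinuousOnInterval.congr {g g' : ℝ → ℝ} {a b : ℝ}
    (hg : AbsolutelyContinuousOnInterval g a b) (h : EqOn g g' (uIcc a b)) :
    AbsolutelyContinuousOnInterval g' a b := by
  rw [absolutelyContinuousOnInterval_iff] at hg ⊢
  intro ε hε
  obtain ⟨δ, hδ, hd⟩ := hg ε hε
  refine ⟨δ, hδ, fun I hI hs => ?_⟩
  refine lt_of_eq_of_lt (Finset.sum_congr rfl fun i hi => ?_) (hd I hI hs)
  rw [h (hI.1 i hi).1, h (hI.1 i hi).2]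

/-! ### The spaces `H¹` and `H¹₀` as vector spaces, and the quadratic form on them. -/

namespace MemH1

variable {f g : G.Point → ℝ}

lemma measurable (hf : MemH1 f) : Measurable f := measurable_of_absCont hf.absCont

lemma integrable_sq (hf : MemH1 f) : Integrable (fun p => f p ^ 2) G.vol := hf.memLp.integrable_sq

lemma integrable_edgeDeriv_sq (hf : MemH1 f) : Integrable (fun p => edgeDeriv f p ^ 2) G.vol :=
  hf.memLp_deriv.integrable_sq

lemma hasSum_mass (hf : MemH1 f) : HasSum (mass f) (∫ p, f p ^ 2 ∂G.vol) := by
  have := hasSum_integral_vol (F := fun p => f p ^ 2) (hf.measurable.pow_const 2) hf.integrable_sq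
  exact this

lemma integral_edgeDeriv_sq_pt (f : G.Point → ℝ) (e : E) :
    ∫ t in (0)..(G.len e), edgeDeriv f (G.pt e t) ^ 2 = energy f e :=
  intervalIntegral_congr_Ioo (G.len_pos e).le fun t ht => by rw [edgeDeriv_pt_of_mem f e ht]

lemma hasSum_energy (hf : MemH1 f) : HasSum (energy f) (form f f) := by
  have := hasSum_integral_vol ((measurable_edgeDeriv f).pow_const 2) hf.integrable_edgeDeriv_sq
  simp only [integral_edgeDeriv_sq_pt] at this
  simpa only [form, sq] using this

lemma intervalIntegrable_derivOn_sq (hf : MemH1 f) (e : E) :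
    IntervalIntegrable (fun t => derivOn f e t ^ 2) volume 0 (G.len e) := by
  have := intervalIntegrable_of_integrable ((measurable_edgeDeriv f).pow_const 2)
    hf.integrable_edgeDeriv_sq e
  refine (intervalIntegrable_congr_Ioo (G.len_pos e).le fun t ht => ?_).1 this
  rw [edgeDeriv_pt_of_mem f e ht]

lemma of_summable [Countable E]
    (h : ∀ e, AbsolutelyContinuousOnInterval (fun s => f (G.pt e s)) 0 (G.len e))
    (hi : ∀ e, IntervalIntegrable (fun t => derivOn f e t ^ 2) volume 0 (G.len e))
    (hm : Summable (mass f)) (he : Summable (energy f)) : MemH1 f := by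
  have hmeas := measurable_of_absCont h
  refine ⟨h, ?_, ?_⟩
  · rw [memLp_two_iff_integrable_sq hmeas.aestronglyMeasurable]
    exact integrable_vol_of_summable (hmeas.pow_const 2) (fun p => sq_nonneg _)
      (fun e => (h e).intervalIntegrable_sq) hm
  · rw [memLp_two_iff_integrable_sq (measurable_edgeDeriv f).aestronglyMeasurable]
    refine integrable_vol_of_summable ((measurable_edgeDeriv f).pow_const 2) (fun p => sq_nonneg _)
      (fun e => ?_) ?_
    · refine (intervalIntegrable_congr_Ioo (G.len_pos e).le fun t ht => ?_).1 (hi e)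
      rw [edgeDeriv_pt_of_mem f e ht]
    · simpa only [integral_edgeDeriv_sq_pt] using he

lemma ae_differentiableAt (hf : MemH1 f) (e : E) :
    ∀ᵐ t, t ∈ Ioo 0 (G.len e) → DifferentiableAt ℝ (fun s => f (G.pt e s)) t := by
  filter_upwards [(hf.absCont e).ae_differentiableAt] with t ht htI
  exact ht (uIcc_of_le (G.len_pos e).le ▸ Ioo_subset_Icc_self htI)

lemma edgeDeriv_add [Countable E] (hf : MemH1 f) (hg : MemH1 g) :
    edgeDeriv (f + g) =ᵐ[G.vol] edgeDeriv f + edgeDeriv g := by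
  rw [Filter.EventuallyEq, ae_vol_iff (measurableSet_eq_fun (measurable_edgeDeriv _)
    ((measurable_edgeDeriv f).add (measurable_edgeDeriv g)))]
  intro e
  filter_upwards [hf.ae_differentiableAt e, hg.ae_differentiableAt e] with t h1 h2 ht
  simp only [Pi.add_apply, edgeDeriv_pt_of_mem _ e ht]
  exact deriv_fun_add (h1 ht) (h2 ht)

lemma _root_.MetricGraph.edgeDeriv_smul (a : ℝ) (f : G.Point → ℝ) :
    edgeDeriv (a • f) = a • edgeDeriv f := by
  ext p
  cases p with
  | vertex v => simp [edgeDeriv]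
  | inner e t ht =>
    simp only [edgeDeriv, Pi.smul_apply, smul_eq_mul]
    exact deriv_const_mul_field a

lemma add [Countable E] (hf : MemH1 f) (hg : MemH1 g) : MemH1 (f + g) :=
  ⟨fun e => (hf.absCont e).add (hg.absCont e), hf.memLp.add hg.memLp,
    (hf.memLp_deriv.add hg.memLp_deriv).ae_eq (hf.edgeDeriv_add hg).symm⟩

lemma smul (hf : MemH1 f) (a : ℝ) : MemH1 (a • f) :=
  ⟨fun e => (hf.absCont e).const_mul a, hf.memLp.const_smul a, by
    rw [edgeDeriv_smul]; exact hf.memLp_deriv.const_smul a⟩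

lemma integrable_mul_edgeDeriv (hf : MemH1 f) (hg : MemH1 g) :
    Integrable (fun p => edgeDeriv f p * edgeDeriv g p) G.vol :=
  hf.memLp_deriv.integrable_mul hg.memLp_deriv

lemma _root_.MeasureTheory.integral_add_mul_add_mul {α : Type*} {m : MeasurableSpace α}
    {ν : Measure α} {φ ψ χ : α → ℝ} (hφ : Integrable φ ν) (hψ : Integrable ψ ν)
    (hχ : Integrable χ ν) (a b : ℝ) :
    ∫ x, (φ x + a * ψ x + b * χ x) ∂ν = ∫ x, φ x ∂ν + a * ∫ x, ψ x ∂ν + b * ∫ x, χ x ∂ν := by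
  have h1 : Integrable (fun x => φ x + a * ψ x) ν := hφ.add (hψ.const_mul a)
  rw [integral_add h1 (hχ.const_mul b), integral_add hφ (hψ.const_mul a), integral_const_mul,
    integral_const_mul]

lemma form_add_smul_self [Countable E] (hf : MemH1 f) (hg : MemH1 g) (a : ℝ) :
    form (f + a • g) (f + a • g) = form f f + 2 * a * form f g + a ^ 2 * form g g := by
  have h := hf.edgeDeriv_add (hg.smul a)
  rw [edgeDeriv_smul] at h
  have h1 : form (f + a • g) (f + a • g) =
      ∫ p, (edgeDeriv f p * edgeDeriv f p + 2 * a * (edgeDeriv f p * edgeDeriv g p) +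
        a ^ 2 * (edgeDeriv g p * edgeDeriv g p)) ∂G.vol := by
    refine integral_congr_ae ?_
    filter_upwards [h] with p hp
    rw [hp]
    simp only [Pi.add_apply, Pi.smul_apply, smul_eq_mul]
    ring
  rw [h1, integral_add_mul_add_mul (hf.integrable_mul_edgeDeriv hf)
    (hf.integrable_mul_edgeDeriv hg) (hg.integrable_mul_edgeDeriv hg)]
  rfl

lemma integral_add_smul_sq (hf : MemH1 f) (hg : MemH1 g) (a : ℝ) :
    ∫ p, (f + a • g) p ^ 2 ∂G.vol = ∫ p, f p ^ 2 ∂G.vol + 2 * a * ∫ p, f p * g p ∂G.vol +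
      a ^ 2 * ∫ p, g p ^ 2 ∂G.vol := by
  have hfg : Integrable (fun p => f p * g p) G.vol := hf.memLp.integrable_mul hg.memLp
  have h1 : ∀ p, (f + a • g) p ^ 2 = f p ^ 2 + 2 * a * (f p * g p) + a ^ 2 * g p ^ 2 := by
    intro p
    simp only [Pi.add_apply, Pi.smul_apply, smul_eq_mul]
    ring
  simp only [h1]
  exact integral_add_mul_add_mul hf.integrable_sq hfg hg.integrable_sq _ _

end MemH1

namespace MemH10

variable {S : Set G.Closure} {f g : G.Point → ℝ}

lemma add [Countable E] (hf : MemH10 S f) (hg : MemH10 S g) : MemH10 S (f + g) :=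
  ⟨hf.memH1.add hg.memH1, fun p hp => by simp [hf.eq_zero p hp, hg.eq_zero p hp],
    fun r hr => by simpa using (hf.tendsto_zero r hr).add (hg.tendsto_zero r hr)⟩

lemma smul (hf : MemH10 S f) (a : ℝ) : MemH10 S (a • f) :=
  ⟨hf.memH1.smul a, fun p hp => by simp [hf.eq_zero p hp],
    fun r hr => by simpa using (hf.tendsto_zero r hr).const_mul a⟩

lemma sub [Countable E] (hf : MemH10 S f) (hg : MemH10 S g) : MemH10 S (f - g) := by
  have := hf.add (hg.smul (-1))
  rwa [neg_one_smul, ← sub_eq_add_neg] at this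

end MemH10

/-! ### Telescoping and summation along chains of edges. -/

namespace Rooting

variable {c : V} {T : Rooting G c}

namespace Continuation

variable (K : T.Continuation)

lemma depth_of_mem_chain {e a : E} {n : ℕ} (h : K.chain e n = some a) :
    T.depth (T.inner a) = T.depth (T.inner e) + n := by
  induction n generalizing a with
  | zero => simp only [chain, Option.some.injEq] at h; rw [h]; rfl
  | succ n ih =>
    obtain ⟨b, hb, hb'⟩ := K.exists_of_chain_succ h
    rw [K.inner_of_succ _ _ hb', T.depth_outer, ih hb, add_assoc]

/-- The sum of a function over the edges of a chain. -/
def chainSum (A : E → ℝ≥0∞) (e : E) : ℝ≥0∞ := ∑' n, (K.chain e n).elim 0 A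

/-- The vertex terms telescope and tend to zero, because the chain ends at a leaf, where `b`
vanishes, or is a ray along which `b` tends to zero. The inequality is kept free of subtraction so
that it makes sense for extended nonnegative sums. -/
lemma add_chainSum_le {A B : E → ℝ≥0∞} {b : V → ℝ≥0∞} {e : E}
    (h : ∀ n a, K.chain e n = some a → b (T.inner a) + A a ≤ B a + b (T.outer a))
    (hleaf : ∀ a, G.degree (T.outer a) = 1 → b (T.outer a) = 0)
    (hray : ∀ a : ℕ → E, a 0 = e → (∀ n, T.inner (a (n + 1)) = T.outer (a n)) →
      Tendsto (fun n => b (T.inner (a n))) atTop (𝓝 0)) :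
    b (T.inner e) + K.chainSum A e ≤ K.chainSum B e := by
  -- The boundary term after `n` edges, with default value zero once the chain has ended.
  set b' : ℕ → ℝ≥0∞ := fun n => (K.chain e n).elim 0 fun a => b (T.inner a) with hb'
  have hstep : ∀ n, b (T.inner e) + ∑ i ∈ Finset.range n, (K.chain e i).elim 0 A ≤
      ∑ i ∈ Finset.range n, (K.chain e i).elim 0 B + b' n := by
    intro n
    induction n with
    | zero => simp [hb', chain]
    | succ n ih =>
      rw [Finset.sum_range_succ, Finset.sum_range_succ, ← add_assoc]
      have key : b' n + (K.chain e n).elim 0 A ≤ (K.chain e n).elim 0 B + b' (n + 1) := by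
        rcases hn : K.chain e n with _ | a
        · simp [hb', hn]
        · simp only [hb', hn, Option.elim_some]
          refine (h n a hn).trans ?_
          gcongr
          rcases hs : K.succ a with _ | a'
          · rw [hleaf a (K.degree_of_succ a hs)]; exact bot_le
          · simp [chain, hn, hs, K.inner_of_succ a a' hs]
      calc _ ≤ (∑ i ∈ Finset.range n, (K.chain e i).elim 0 B + b' n) +
            (K.chain e n).elim 0 A := by gcongr
        _ ≤ _ := by rw [add_assoc, add_assoc]; gcongr
  have hlim : Tendsto b' atTop (𝓝 0) := by
    rcases K.chain_cases e with ⟨n, a, hn, ha⟩ | ⟨a, ha0, ha, ha'⟩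
    · refine tendsto_const_nhds.congr' ?_
      filter_upwards [eventually_ge_atTop (n + 1)] with m hm
      have : K.chain e m = none := by
        induction m, hm using Nat.le_induction with
        | base => simp [chain, hn, ha]
        | succ m _ ih => simp [chain, ih]
      simp [hb', this]
    · refine (hray a ha0 ha').congr fun n => ?_
      simp [hb', ha]
  have h1 : Tendsto (fun n => b (T.inner e) + ∑ i ∈ Finset.range n, (K.chain e i).elim 0 A) atTop
      (𝓝 (b (T.inner e) + K.chainSum A e)) :=
    tendsto_const_nhds.add (ENNReal.tendsto_nat_tsum _)
  have h2 : Tendsto (fun n => ∑ i ∈ Finset.range n, (K.chain e i).elim 0 B + b' n) atTop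
      (𝓝 (K.chainSum B e + 0)) := (ENNReal.tendsto_nat_tsum _).add hlim
  rw [add_zero] at h2
  exact le_of_tendsto_of_tendsto' h1 h2 hstep

lemma tsum_isSome (F : E → ℝ≥0∞) {ι : Type*} (g : ι → Option E) :
    ∑' i, (g i).elim 0 F = ∑' i : {i // (g i).isSome}, F ((g i).get i.2) := by
  have h : Function.support (fun i => (g i).elim 0 F) ⊆ {i | (g i).isSome} := by
    intro i hi
    rw [Function.mem_support] at hi
    rw [mem_ofPred_eq]
    by_contra hne
    simp only [Bool.not_eq_true, Option.isSome_eq_false_iff, Option.isNone_iff_eq_none] at hne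
    exact hi (by simp [hne])
  rw [← tsum_subtype_eq_of_support_subset h]
  refine tsum_congr fun i => ?_
  obtain ⟨i, hi⟩ := i
  obtain ⟨a, ha⟩ := Option.isSome_iff_exists.1 (show (g i).isSome from hi)
  simp [ha]

lemma chainSum_le_tsum (F : E → ℝ≥0∞) (e : E) : K.chainSum F e ≤ ∑' a, F a := by
  unfold chainSum
  rw [tsum_isSome F]
  refine ENNReal.tsum_comp_le_tsum_of_injective
    (f := fun i : {n // (K.chain e n).isSome} => (K.chain e i).get i.2) ?_ F
  rintro ⟨n, hn⟩ ⟨m, hm⟩ hnm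
  have h1 := K.depth_of_mem_chain (Option.some_get hn).symm
  have h2 := K.depth_of_mem_chain (Option.some_get hm).symm
  simp only at hnm
  rw [hnm, h2] at h1
  simp only [Subtype.mk.injEq]
  omega

/-- A set of edges which is closed under continuation is partitioned into chains. -/
lemma tsum_eq_tsum_chainSum {D : Set E} (hD : ∀ e ∈ D, ∀ e', K.succ e = some e' → e' ∈ D)
    (F : E → ℝ≥0∞) :
    ∑' e : D, F e = ∑' s : {e : D // ∀ a : D, K.succ a ≠ some (e : E)}, K.chainSum F s := by
  -- The initial edges of the chains: those that continue no edge of `D`.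
  set I := {e : D // ∀ a : D, K.succ a ≠ some (e : E)}
  have hmem : ∀ s ∈ D, ∀ n a, K.chain s n = some a → a ∈ D := by
    intro s hs n
    induction n with
    | zero => intro a h; simp only [chain, Option.some.injEq] at h; exact h ▸ hs
    | succ n ih =>
      intro a h
      obtain ⟨b, hb, hb'⟩ := K.exists_of_chain_succ h
      exact hD b (ih b hb) a hb'
  -- An edge continues at most one other edge. Tracing two chains back from a common edge therefore
  -- reaches the same initial edge in the same number of steps.
  have hinj : ∀ n m (s s' : I) a, K.chain s n = some a → K.chain s' m = some a →
      s = s' ∧ n = m := by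
    intro n
    induction n with
    | zero =>
      intro m s s' a h h'
      simp only [chain, Option.some.injEq] at h
      rcases m with _ | m
      · simp only [chain, Option.some.injEq] at h'
        exact ⟨Subtype.ext (Subtype.ext (h.trans h'.symm)), rfl⟩
      · obtain ⟨b, hb, hb'⟩ := K.exists_of_chain_succ h'
        exact absurd (h ▸ hb') (s.2 ⟨b, hmem _ s'.1.2 _ _ hb⟩)
    | succ n ih =>
      intro m s s' a h h'
      obtain ⟨b, hb, hb'⟩ := K.exists_of_chain_succ h
      rcases m with _ | m
      · simp only [chain, Option.some.injEq] at h'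
        exact absurd (h' ▸ hb') (s'.2 ⟨b, hmem _ s.1.2 _ _ hb⟩)
      · obtain ⟨b', hb1, hb2⟩ := K.exists_of_chain_succ h'
        obtain rfl := K.succ_injective hb' hb2
        obtain ⟨h1, h2⟩ := ih m s s' b hb hb1
        exact ⟨h1, by rw [h2]⟩
  -- Tracing back lowers the depth, so it stops at an initial edge.
  have hsurj : ∀ a ∈ D, ∃ (s : I) (n : ℕ), K.chain s n = some a := by
    intro a ha
    induction hn : T.depth (T.inner a) using Nat.strong_induction_on generalizing a with
    | _ n ih =>
      by_cases hs : ∀ b : D, K.succ b ≠ some a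
      · exact ⟨⟨⟨a, ha⟩, hs⟩, 0, rfl⟩
      · push Not at hs
        obtain ⟨b, hb⟩ := hs
        have hlt : T.depth (T.inner (b : E)) < n := by
          rw [← hn, K.inner_of_succ _ _ hb, T.depth_outer]
          exact Nat.lt_succ_self _
        obtain ⟨s, m, hm⟩ := ih _ hlt b b.2 rfl
        exact ⟨s, m + 1, by simp [chain, hm, hb]⟩
  have h1 : ∑' s : I, K.chainSum F s =
      ∑' p : {p : I × ℕ // (K.chain p.1 p.2).isSome}, F ((K.chain p.1.1 p.1.2).get p.2) := by
    rw [← tsum_isSome F (fun p : I × ℕ => K.chain p.1 p.2)]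
    exact (ENNReal.tsum_prod (f := fun (s : I) n => (K.chain s n).elim 0 F)).symm
  rw [h1]
  let φ : {p : I × ℕ // (K.chain p.1 p.2).isSome} → D := fun p =>
    ⟨(K.chain p.1.1 p.1.2).get p.2, hmem _ p.1.1.1.2 _ _ (Option.some_get p.2).symm⟩
  have hφ : Function.Bijective φ := by
    constructor
    · rintro ⟨⟨s, n⟩, hp⟩ ⟨⟨s', m⟩, hq⟩ hpq
      have hpq' : (K.chain s n).get hp = (K.chain s' m).get hq := congrArg Subtype.val hpq
      obtain ⟨h2, h3⟩ := hinj n m s s' _ (Option.some_get hp).symm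
        (hpq' ▸ (Option.some_get hq).symm)
      subst h2 h3
      rfl
    · rintro ⟨a, ha⟩
      obtain ⟨s, n, hn⟩ := hsurj a ha
      exact ⟨⟨(s, n), by simp [hn]⟩, Subtype.ext (by simp [φ, hn])⟩
  exact ((Equiv.ofBijective φ hφ).tsum_eq (fun e : D => F e)).symm

lemma tsum_le_tsum_of_chainSum_le {D : Set E}
    (hD : ∀ e ∈ D, ∀ e', K.succ e = some e' → e' ∈ D) {A B : E → ℝ≥0∞}
    (h : ∀ e ∈ D, K.chainSum A e ≤ K.chainSum B e) : ∑' e : D, A e ≤ ∑' e : D, B e := by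
  rw [K.tsum_eq_tsum_chainSum hD, K.tsum_eq_tsum_chainSum hD]
  exact ENNReal.tsum_le_tsum fun s => h s s.1.2

end Continuation

end Rooting

/-! ### Picone's inequality on the tree and its consequences. -/

namespace Rooting

variable {c : V} (T : Rooting G c)

lemma cos_pos_of_abs {κ y R : ℝ} (hκ : 0 < κ) (hR : κ * R < Real.pi / 2) (hy : |y| ≤ R) :
    0 < Real.cos (κ * y) := by
  have h1 : |κ * y| ≤ κ * R := by
    rw [abs_mul, abs_of_pos hκ]
    exact mul_le_mul_of_nonneg_left hy hκ.le
  have h2 := abs_le.1 h1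
  exact Real.cos_pos_of_mem_Ioo ⟨by linarith, by linarith⟩

/-- Picone's inequality on a single edge, oriented away from the root. -/
lemma edge_picone {R κ x₀ : ℝ} (hκ : 0 < κ) (hκR : κ * (R - x₀) < Real.pi / 2)
    (hH : ∀ e, T.height (T.outer e) ≤ R) {f : G.Point → ℝ} (hf : MemH1 f) {e : E}
    (he : x₀ ≤ T.height (T.inner e)) :
    f (.vertex (T.inner e)) ^ 2 * (κ * Real.tan (κ * (T.height (T.inner e) - x₀))) +
      κ ^ 2 * mass f e ≤ energy f e +
      f (.vertex (T.outer e)) ^ 2 * (κ * Real.tan (κ * (T.height (T.outer e) - x₀))) := by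
  have hp := G.len_pos e
  have ho := T.height_outer e
  have hHe := hH e
  have key : ∀ a, (∀ t ∈ Icc 0 (G.len e), |t - a| ≤ R - x₀) →
      f (G.pt e 0) ^ 2 * (κ * Real.tan (κ * (0 - a))) + κ ^ 2 * mass f e ≤
        energy f e + f (G.pt e (G.len e)) ^ 2 * (κ * Real.tan (κ * (G.len e - a))) := by
    intro a ha
    exact picone_le (g := fun s => f (G.pt e s)) (W := fun t => κ * Real.tan (κ * (t - a)))
      hp.le (hf.absCont e) (hf.intervalIntegrable_derivOn_sq e) fun t ht =>
      hasDerivAt_mul_tan (cos_pos_of_abs hκ hκR (ha t ht)).ne'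
  rcases T.joins e with ⟨h1, h2⟩ | ⟨h1, h2⟩
  · have := key (x₀ - T.height (T.inner e)) fun t ht => by
      rw [abs_of_nonneg] <;> linarith [ht.1, ht.2]
    rw [pt_zero, pt_len, h1, h2] at this
    convert this using 6 <;> linarith
  -- Here the parametrization runs towards the root. The height is decreasing in `t`, so the Riccati
  -- solution in `t` is the negative of the weight, and the two boundary terms change places.
  · have := key (T.height (T.outer e) - x₀) fun t ht => by
      rw [abs_of_nonpos] <;> linarith [ht.1, ht.2]
    rw [pt_zero, pt_len, h1, h2] at this
    have h3 : κ * (0 - (T.height (T.outer e) - x₀)) = -(κ * (T.height (T.outer e) - x₀)) := by ring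
    have h4 : κ * (G.len e - (T.height (T.outer e) - x₀)) =
        -(κ * (T.height (T.inner e) - x₀)) := by rw [ho]; ring
    rw [h3, h4, Real.tan_neg, Real.tan_neg] at this
    linarith

lemma mul_tan_nonneg {R κ x₀ x : ℝ} (hκ : 0 < κ) (hκR : κ * (R - x₀) < Real.pi / 2)
    (h0 : x₀ ≤ x) (h1 : x ≤ R) : 0 ≤ κ * Real.tan (κ * (x - x₀)) := by
  have : κ * (x - x₀) ≤ κ * (R - x₀) := by gcongr
  exact mul_nonneg hκ.le (Real.tan_nonneg_of_nonneg_of_le_pi_div_two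
    (mul_nonneg hκ.le (sub_nonneg.2 h0)) (this.trans hκR.le))

lemma mul_tan_le {R κ x₀ x y : ℝ} (hκ : 0 < κ) (hκR : κ * (R - x₀) < Real.pi / 2)
    (h0 : x₀ ≤ x) (hxy : x ≤ y) (h1 : y ≤ R) :
    κ * Real.tan (κ * (x - x₀)) ≤ κ * Real.tan (κ * (y - x₀)) := by
  have h2 : κ * (x - x₀) ≤ κ * (y - x₀) := by gcongr
  have h3 : κ * (y - x₀) ≤ κ * (R - x₀) := by gcongr
  have h4 : 0 ≤ κ * (x - x₀) := mul_nonneg hκ.le (sub_nonneg.2 h0)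
  refine mul_le_mul_of_nonneg_left ?_ hκ.le
  exact Real.strictMonoOn_tan.monotoneOn ⟨by linarith, by linarith⟩ ⟨by linarith, by linarith⟩ h2

variable {T} in
-- The edge inequalities telescope along the chain. The first boundary term is retained because it
-- yields the pointwise bound on `f`.
lemma Continuation.picone_chain (K : T.Continuation) {R κ x₀ : ℝ} (hκ : 0 < κ)
    (hκR : κ * (R - x₀) < Real.pi / 2) (hH : ∀ e, T.height (T.outer e) ≤ R)
    {f : G.Point → ℝ} (hf : MemH10 (G.dirichletSet c) f) {e : E}
    (he : x₀ ≤ T.height (T.inner e)) :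
    ENNReal.ofReal
        (f (.vertex (T.inner e)) ^ 2 * (κ * Real.tan (κ * (T.height (T.inner e) - x₀)))) +
      K.chainSum (fun a => ENNReal.ofReal (κ ^ 2 * mass f a)) e ≤
      K.chainSum (fun a => ENNReal.ofReal (energy f a)) e := by
  set w : ℝ → ℝ := fun x => κ * Real.tan (κ * (x - x₀)) with hw
  have hHi : ∀ a, T.height (T.inner a) ≤ R := fun a => (T.height_inner_lt a).le.trans (hH a)
  refine K.add_chainSum_le
    (b := fun v => ENNReal.ofReal (f (.vertex v) ^ 2 * w (T.height v))) ?_ ?_ ?_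
  · intro n a hn
    have hx := he.trans (K.height_le_of_mem_chain hn)
    have h0 := mul_tan_nonneg hκ hκR hx (hHi a)
    have h1 := mul_tan_nonneg hκ hκR (hx.trans (T.height_inner_lt a).le) (hH a)
    rw [← ENNReal.ofReal_add (mul_nonneg (sq_nonneg _) h0)
      (mul_nonneg (sq_nonneg _) (mass_nonneg f a)), ← ENNReal.ofReal_add (energy_nonneg f a)
      (mul_nonneg (sq_nonneg _) h1)]
    exact ENNReal.ofReal_le_ofReal (T.edge_picone hκ hκR hH hf.memH1 hx)
  · intro a ha
    simp [hf.eq_zero _ (T.leaf_mem_dirichletSet a ha)]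
  · intro a ha0 ha
    have h1 := hf.tendsto_zero (T.outwardRay a ha) (end_mem_dirichletSet _)
    have h2 : Tendsto (fun n => f (.vertex (T.inner (a n)))) atTop (𝓝 0) := h1
    -- As `κ * (R - x₀) < π / 2`, the weight is bounded by its finite value at height `R`, so the
    -- decay of `f` along the ray suffices.
    have h3 : Tendsto (fun n => ENNReal.ofReal (f (.vertex (T.inner (a n))) ^ 2 * w R)) atTop
        (𝓝 0) := by
      have := ENNReal.tendsto_ofReal ((h2.pow 2).mul_const (w R))
      simpa using this
    refine tendsto_of_tendsto_of_tendsto_of_le_of_le tendsto_const_nhds h3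
      (fun _ => bot_le) fun n => ?_
    apply ENNReal.ofReal_le_ofReal
    refine mul_le_mul_of_nonneg_left ?_ (sq_nonneg _)
    refine mul_tan_le hκ hκR ?_ (hHi _) le_rfl
    refine he.trans ?_
    rw [← ha0]
    exact T.height_inner_monotone a ha (Nat.zero_le n)

/-- The Friedrichs inequality for the part of the tree above the height `x₀`. -/
lemma mul_tsum_mass_le {R κ x₀ : ℝ} (hκ : 0 < κ) (hκR : κ * (R - x₀) < Real.pi / 2)
    (hH : ∀ e, T.height (T.outer e) ≤ R) {f : G.Point → ℝ}
    (hf : MemH10 (G.dirichletSet c) f) :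
    κ ^ 2 * ∑' e : {e | x₀ ≤ T.height (T.inner e)}, mass f e ≤
      ∑' e : {e | x₀ ≤ T.height (T.inner e)}, energy f e := by
  obtain ⟨K⟩ := T.exists_continuation
  have h := K.tsum_le_tsum_of_chainSum_le (D := {e | x₀ ≤ T.height (T.inner e)})
    (A := fun a => ENNReal.ofReal (κ ^ 2 * mass f a)) (B := fun a => ENNReal.ofReal (energy f a))
    (fun e he e' hs => by
      have he' : x₀ ≤ T.height (T.inner e) := he
      rw [mem_ofPred_eq, K.inner_of_succ _ _ hs]
      exact he'.trans (T.height_inner_lt e).le)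
    -- For the mass estimate the nonnegative first boundary term is dropped.
    (fun e he => le_add_self.trans (K.picone_chain hκ hκR hH hf he))
  have hs1 : Summable fun e : {e | x₀ ≤ T.height (T.inner e)} => mass f e :=
    hf.memH1.hasSum_mass.summable.subtype _
  have hs2 : Summable fun e : {e | x₀ ≤ T.height (T.inner e)} => energy f e :=
    hf.memH1.hasSum_energy.summable.subtype _
  have h1 := ENNReal.ofReal_tsum_of_nonneg
    (f := fun e : {e | x₀ ≤ T.height (T.inner e)} => κ ^ 2 * mass f e)
    (fun e => mul_nonneg (sq_nonneg κ) (mass_nonneg f e)) (hs1.mul_left _)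
  have h2 := ENNReal.ofReal_tsum_of_nonneg (fun e => energy_nonneg f _) hs2
  rw [← h1, ← h2, ENNReal.ofReal_le_ofReal_iff (tsum_nonneg fun e => energy_nonneg f _),
    tsum_mul_left] at h
  exact h

/-- The Friedrichs inequality on a tree of height at most `R`. -/
lemma mul_integral_sq_le_form {R : ℝ} (hR : 0 < R) (hH : ∀ e, T.height (T.outer e) ≤ R)
    {f : G.Point → ℝ} (hf : MemH10 (G.dirichletSet c) f) :
    Real.pi ^ 2 / (4 * R ^ 2) * ∫ p, f p ^ 2 ∂G.vol ≤ form f f := by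
  -- At `κ = π / (2 R)` the tangent blows up at height `R`, so the endpoint is reached only as a
  -- limit from the left. With `x₀ = 0` the part above `x₀` is the whole tree.
  have h1 : ∀ κ, 0 < κ → κ < Real.pi / (2 * R) → κ ^ 2 * ∫ p, f p ^ 2 ∂G.vol ≤ form f f := by
    intro κ hκ hκ'
    have hκR : κ * (R - 0) < Real.pi / 2 := by
      rw [lt_div_iff₀ (by positivity)] at hκ'
      linarith
    have h := T.mul_tsum_mass_le hκ hκR hH hf
    have hu : {e | 0 ≤ T.height (T.inner e)} = univ := eq_univ_of_forall fun e => T.height_nonneg _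
    rw [hu, tsum_univ (mass f), tsum_univ (energy f), hf.memH1.hasSum_mass.tsum_eq,
      hf.memH1.hasSum_energy.tsum_eq] at h
    exact h
  have h2 : Tendsto (fun κ : ℝ => κ ^ 2 * ∫ p, f p ^ 2 ∂G.vol) (𝓝[<] (Real.pi / (2 * R)))
      (𝓝 ((Real.pi / (2 * R)) ^ 2 * ∫ p, f p ^ 2 ∂G.vol)) :=
    (by fun_prop : Continuous fun κ : ℝ => κ ^ 2 * ∫ p, f p ^ 2 ∂G.vol).continuousAt.tendsto.mono_left
      nhdsWithin_le_nhds
  have h3 : (Real.pi / (2 * R)) ^ 2 = Real.pi ^ 2 / (4 * R ^ 2) := by ring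
  rw [← h3]
  refine le_of_tendsto h2 ?_
  filter_upwards [Ioo_mem_nhdsLT (show 0 < Real.pi / (2 * R) by positivity)] with κ hκ
  exact h1 κ hκ.1 hκ.2

/-- The values of a function in `H¹₀` are controlled by its energy. -/
lemma exists_sq_le_mul_form [Nonempty E] {R : ℝ} (hR : 0 < R)
    (hH : ∀ e, T.height (T.outer e) ≤ R) :
    ∃ C : ℝ, 0 < C ∧ ∀ f : G.Point → ℝ, MemH10 (G.dirichletSet c) f →
      ∀ p, f p ^ 2 ≤ C * form f f := by
  obtain ⟨K⟩ := T.exists_continuation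
  -- Starting the tangent at height `-1` makes the weight at least `m > 0` on all heights from `0`
  -- to `R`, while `κ * (R + 1) = 1` stays below `π / 2`.
  set κ := (R + 1)⁻¹ with hκd
  have hκ : 0 < κ := by positivity
  have hκR : κ * (R - (-1)) < Real.pi / 2 := by
    rw [sub_neg_eq_add, hκd, inv_mul_cancel₀ (by positivity)]
    linarith [Real.pi_gt_three]
  set m := κ * Real.tan (κ * (0 - (-1))) with hm
  have hκ1 : κ < Real.pi / 2 := by
    refine lt_of_le_of_lt ?_ hκR
    exact le_mul_of_one_le_right hκ.le (by linarith)
  have hm0 : 0 < m := by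
    refine mul_pos hκ (Real.tan_pos_of_pos_of_lt_pi_div_two ?_ ?_) <;> simpa
  have hHi : ∀ a, T.height (T.inner a) ≤ R := fun a => (T.height_inner_lt a).le.trans (hH a)
  have hform : ∀ f : G.Point → ℝ, 0 ≤ form f f := fun f => integral_nonneg fun p => mul_self_nonneg _
  have hinner : ∀ f : G.Point → ℝ, MemH10 (G.dirichletSet c) f → ∀ e,
      f (.vertex (T.inner e)) ^ 2 ≤ m⁻¹ * form f f := by
    intro f hf e
    have h0 : (-1 : ℝ) ≤ T.height (T.inner e) := by linarith [T.height_nonneg (T.inner e)]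
    have h1 := (le_self_add.trans (K.picone_chain hκ hκR hH hf h0)).trans
      (K.chainSum_le_tsum _ _)
    rw [← ENNReal.ofReal_tsum_of_nonneg (fun e => energy_nonneg f e)
      hf.memH1.hasSum_energy.summable, hf.memH1.hasSum_energy.tsum_eq,
      ENNReal.ofReal_le_ofReal_iff (hform f)] at h1
    have h2 : m ≤ κ * Real.tan (κ * (T.height (T.inner e) - (-1))) :=
      mul_tan_le hκ hκR (by norm_num) (T.height_nonneg _) (hHi e)
    rw [inv_mul_eq_div, le_div_iff₀ hm0]
    exact (mul_le_mul_of_nonneg_left h2 (sq_nonneg _)).trans h1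
  have hvert : ∀ f : G.Point → ℝ, MemH10 (G.dirichletSet c) f → ∀ v,
      f (.vertex v) ^ 2 ≤ m⁻¹ * form f f := by
    intro f hf v
    by_cases hv : v = c
    · obtain ⟨e, he⟩ := T.exists_inner_eq_root
      rw [hv, ← he]
      exact hinner f hf e
    · by_cases hd : G.degree v = 1
      · rw [hf.eq_zero _ (Or.inr ⟨v, hv, hd, rfl⟩)]
        rw [zero_pow two_ne_zero]
        exact mul_nonneg (inv_pos.2 hm0).le (hform f)
      · obtain ⟨e, rfl⟩ := T.exists_inner_of_degree_ne_one hv hd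
        exact hinner f hf e
  refine ⟨2 * m⁻¹ + 2 * R, by positivity, fun f hf p => ?_⟩
  cases p with
  | vertex v =>
    have h1 := hvert f hf v
    have h2 := hform f
    have h3 : 0 ≤ m⁻¹ * form f f := by positivity
    have h4 : 0 ≤ R * form f f := by positivity
    linarith
  | inner e t ht =>
    have h1 := hvert f hf (G.init e)
    have h2 := sq_sub_le_mul_integral (hf.memH1.absCont e)
      (hf.memH1.intervalIntegrable_derivOn_sq e) le_rfl ht.1.le ht.2.le
    have h3 : energy f e ≤ form f f :=
      le_hasSum hf.memH1.hasSum_energy e fun a _ => energy_nonneg f a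
    have h4 : (t - 0) * energy f e ≤ R * form f f := by
      refine mul_le_mul ?_ h3 (energy_nonneg f e) hR.le
      have := T.height_outer e
      linarith [hH e, T.height_nonneg (T.inner e), ht.2]
    have h5 : (f (G.pt e t) - f (G.pt e 0)) ^ 2 ≤ R * form f f := h2.trans h4
    rw [pt_zero, pt_of_mem e ht] at h5
    nlinarith [sq_nonneg (f (.inner e t ht) - 2 * f (.vertex (G.init e)))]

/-- The `L²`-norm of a function in `H¹₀` is controlled by finitely many of its values, up to a
small multiple of the energy. -/
lemma exists_integral_sq_le_sample {R : ℝ} (hR : 0 < R) (hH : ∀ e, T.height (T.outer e) ≤ R)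
    (hfin : ∀ s < R, {e | T.height (T.inner e) ≤ s}.Finite) {ε : ℝ} (hε : 0 < ε) :
    ∃ (F : Finset E) (N : ℕ), ∀ f : G.Point → ℝ, MemH10 (G.dirichletSet c) f →
      ∫ p, f p ^ 2 ∂G.vol ≤ ε * form f f +
        ∑ e ∈ F, 2 * (G.len e / N) *
          ∑ k ∈ Finset.range N, f (G.pt e (k * (G.len e / N))) ^ 2 := by
  classical
  -- With `κ = s⁻¹` and `x₀ = R - s`, the product `κ * (R - x₀)` is `1`, and the mass above `x₀` is
  -- at most `s ^ 2 = ε / 2` times the energy there.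
  set s := Real.sqrt (ε / 2) with hs
  have hs0 : 0 < s := Real.sqrt_pos.2 (by positivity)
  have hs2 : s ^ 2 = ε / 2 := Real.sq_sqrt (by positivity)
  set x₀ := R - s with hx₀
  have hD : {e | T.height (T.inner e) < x₀}.Finite :=
    (hfin x₀ (by linarith)).subset fun e (he : T.height (T.inner e) < x₀) => he.le
  -- All edge lengths are at most `R`, so this `N` makes the energy coefficient `2 * len ^ 2 / N` of
  -- the sampling estimate at most `ε / 2`.
  obtain ⟨N, hN⟩ := exists_nat_gt (4 * R ^ 2 / ε)
  have hN0 : (0 : ℝ) < N := lt_of_le_of_lt (by positivity) hN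
  refine ⟨hD.toFinset, N, fun f hf => ?_⟩
  have hsm := hf.memH1.hasSum_mass
  have hse := hf.memH1.hasSum_energy
  have hκR : s⁻¹ * (R - x₀) < Real.pi / 2 := by
    have : R - x₀ = s := by rw [hx₀]; ring
    rw [this, inv_mul_cancel₀ hs0.ne']
    linarith [Real.pi_gt_three]
  have h1 := T.mul_tsum_mass_le (inv_pos.2 hs0) hκR hH hf
  rw [inv_pow, inv_mul_le_iff₀ (by positivity), hs2] at h1
  have hcompl : {e | x₀ ≤ T.height (T.inner e)} = (↑hD.toFinset : Set E)ᶜ := by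
    ext e; simp
  rw [hcompl] at h1
  have h2 := hsm.summable.sum_add_tsum_compl (s := hD.toFinset)
  have h3 := hse.summable.sum_add_tsum_compl (s := hD.toFinset)
  rw [hsm.tsum_eq] at h2
  rw [hse.tsum_eq] at h3
  have h4 : ∑ e ∈ hD.toFinset, mass f e ≤ ∑ e ∈ hD.toFinset, (2 * (G.len e / N) *
      ∑ k ∈ Finset.range N, f (G.pt e (k * (G.len e / N))) ^ 2 + ε / 2 * energy f e) := by
    refine Finset.sum_le_sum fun e _ => ?_
    refine (integral_sq_le_sum_sample (G.len_pos e) (hf.memH1.absCont e)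
      (hf.memH1.intervalIntegrable_derivOn_sq e) (by exact_mod_cast hN0)).trans ?_
    refine add_le_add le_rfl ?_
    refine mul_le_mul_of_nonneg_right ?_ (energy_nonneg f e)
    have hl : G.len e ≤ R := by
      have := T.height_outer e
      linarith [hH e, T.height_nonneg (T.inner e)]
    have hl2 : G.len e ^ 2 ≤ R ^ 2 := by
      have := G.len_pos e
      gcongr
    rw [div_lt_iff₀ hε] at hN
    have : 2 * (G.len e / N) * G.len e = 2 * G.len e ^ 2 / N := by ring
    rw [this, div_le_iff₀ hN0]
    linarith
  rw [Finset.sum_add_distrib, ← Finset.mul_sum] at h4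
  have h5 : 0 ≤ ∑' e : ↥((↑hD.toFinset : Set E)ᶜ), energy f e := tsum_nonneg fun e => energy_nonneg f e
  have h6 : 0 ≤ ∑ e ∈ hD.toFinset, energy f e := Finset.sum_nonneg fun e _ => energy_nonneg f e
  rw [← h2, ← h3, mul_add]
  have h7 := mul_nonneg hε.le h5
  have h8 := mul_nonneg hε.le h6
  linarith

end Rooting

/-! ### Completeness of `H¹₀` -/

lemma _root_.MeasureTheory.MemLp.norm_toLp_sq {α : Type*} {m : MeasurableSpace α} {ν : Measure α}
    {φ : α → ℝ} (h : MemLp φ 2 ν) : ‖h.toLp‖ ^ 2 = ∫ x, φ x ^ 2 ∂ν := by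
  rw [← real_inner_self_eq_norm_sq, L2.inner_def]
  refine integral_congr_ae ?_
  filter_upwards [h.coeFn_toLp] with x hx
  simp [hx, sq]

lemma form_self_nonneg (f : G.Point → ℝ) : 0 ≤ form f f :=
  integral_nonneg fun _ => mul_self_nonneg _

lemma form_self (f : G.Point → ℝ) : form f f = ∫ p, edgeDeriv f p ^ 2 ∂G.vol := by
  simp only [form, sq]

lemma MemH1.sub [Countable E] {f g : G.Point → ℝ} (hf : MemH1 f) (hg : MemH1 g) :
    MemH1 (f - g) := by
  have := hf.add (hg.smul (-1))
  rwa [neg_one_smul, ← sub_eq_add_neg] at this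

lemma MemH1.edgeDeriv_sub [Countable E] {f g : G.Point → ℝ} (hf : MemH1 f) (hg : MemH1 g) :
    edgeDeriv (f - g) =ᵐ[G.vol] edgeDeriv f - edgeDeriv g := by
  have := hf.edgeDeriv_add (hg.smul (-1))
  rw [edgeDeriv_smul, neg_one_smul, neg_one_smul, ← sub_eq_add_neg, ← sub_eq_add_neg] at this
  exact this

lemma MemH1.norm_toLp_edgeDeriv_sub_sq [Countable E] {f g : G.Point → ℝ} (hf : MemH1 f)
    (hg : MemH1 g) :
    ‖hf.memLp_deriv.toLp - hg.memLp_deriv.toLp‖ ^ 2 = form (f - g) (f - g) := by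
  rw [← MemLp.toLp_sub, MemLp.norm_toLp_sq, form_self]
  refine integral_congr_ae ?_
  filter_upwards [hf.edgeDeriv_sub hg] with p hp
  rw [hp]

/-- An indefinite integral along an edge. -/
lemma absCont_and_deriv_of_eq_integral {g v : ℝ → ℝ} {ℓ : ℝ} (hℓ : 0 ≤ ℓ)
    (hv : IntervalIntegrable v volume 0 ℓ)
    (hg : ∀ t ∈ Icc 0 ℓ, g t = g 0 + ∫ s in (0)..t, v s) :
    AbsolutelyContinuousOnInterval g 0 ℓ ∧ ∀ᵐ t, t ∈ Ioo 0 ℓ → deriv g t = v t := by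
  have hu : uIcc 0 ℓ = Icc 0 ℓ := uIcc_of_le hℓ
  constructor
  · have h1 := hv.absolutelyContinuousOnInterval_intervalIntegral (c := 0) (by simp)
    have h2 : AbsolutelyContinuousOnInterval (fun _ : ℝ => g 0) 0 ℓ :=
      ContDiffOn.absolutelyContinuousOnInterval contDiffOn_const
    refine (h2.add h1).congr fun t ht => ?_
    rw [hg t (hu ▸ ht)]
    rfl
  · filter_upwards [hv.ae_hasDerivAt_integral] with t ht htI
    have h1 := (ht (hu ▸ Ioo_subset_Icc_self htI) 0 (by simp)).const_add (g 0)
    refine (h1.congr_of_eventuallyEq ?_).deriv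
    filter_upwards [isOpen_Ioo.mem_nhds htI] with s hs
    exact hg s (Ioo_subset_Icc_self hs)

variable {S : Set G.Closure}

/-- If the energy controls the values and the `L²`-norm, then `H¹₀` is complete with respect to the
energy. -/
lemma MemH10.exists_tendsto [Countable E] {C C' : ℝ} (hC' : 0 ≤ C')
    (hpt : ∀ f : G.Point → ℝ, MemH10 S f → ∀ p, f p ^ 2 ≤ C * form f f)
    (hL2 : ∀ f : G.Point → ℝ, MemH10 S f → ∫ p, f p ^ 2 ∂G.vol ≤ C' * form f f)
    {ι : Type*} {l : Filter ι} [l.NeBot] {f : ι → G.Point → ℝ} (hf : ∀ i, MemH10 S (f i))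
    (hcau : Tendsto (fun x : ι × ι => form (f x.1 - f x.2) (f x.1 - f x.2)) (l ×ˢ l) (𝓝 0)) :
    ∃ g, MemH10 S g ∧ Tendsto (fun i => form (f i - g) (f i - g)) l (𝓝 0) := by
  set φ : ι → Lp ℝ 2 G.vol := fun i => (hf i).memH1.memLp_deriv.toLp with hφ
  have hφc : Cauchy (map φ l) := by
    rw [cauchy_map_iff', tendsto_uniformity_iff_dist_tendsto_zero]
    have h1 := hcau.sqrt
    rw [Real.sqrt_zero] at h1
    refine h1.congr fun x => ?_
    rw [← (hf x.1).memH1.norm_toLp_edgeDeriv_sub_sq (hf x.2).memH1, Real.sqrt_sq (norm_nonneg _),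
      dist_eq_norm]
  obtain ⟨w, hw⟩ := CompleteSpace.complete hφc
  have hw : Tendsto φ l (𝓝 w) := hw
  have hwm : Measurable w := (Lp.stronglyMeasurable w).measurable
  have hwsq : Integrable (fun p => w p ^ 2) G.vol := (Lp.memLp w).integrable_sq
  have hdw : Tendsto (fun i => ∫ p, (edgeDeriv (f i) p - w p) ^ 2 ∂G.vol) l (𝓝 0) := by
    have h1 := ((tendsto_iff_norm_sub_tendsto_zero.1 hw).pow 2)
    rw [zero_pow two_ne_zero] at h1
    refine h1.congr fun i => ?_
    have h2 : φ i - w = ((hf i).memH1.memLp_deriv.sub (Lp.memLp w)).toLp := by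
      rw [MemLp.toLp_sub (hf i).memH1.memLp_deriv (Lp.memLp w), Lp.toLp_coeFn]
    rw [h2, MemLp.norm_toLp_sq]
    rfl
  have hdiff : ∀ i j p, (f i p - f j p) ^ 2 ≤ C * form (f i - f j) (f i - f j) := fun i j p =>
    hpt _ ((hf i).sub (hf j)) p
  have hcauC : Tendsto (fun x : ι × ι => C * form (f x.1 - f x.2) (f x.1 - f x.2)) (l ×ˢ l)
      (𝓝 0) := by simpa using hcau.const_mul C
  have hlim : ∀ p, ∃ a, Tendsto (fun i => f i p) l (𝓝 a) := by
    intro p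
    refine cauchy_map_iff_exists_tendsto.1 ?_
    rw [cauchy_map_iff', tendsto_uniformity_iff_dist_tendsto_zero]
    have h1 := hcauC.sqrt
    rw [Real.sqrt_zero] at h1
    refine squeeze_zero (fun _ => dist_nonneg) (fun x => ?_) h1
    rw [Real.dist_eq]
    exact Real.le_sqrt_of_sq_le (by rw [sq_abs]; exact hdiff x.1 x.2 p)
  choose g hg using hlim
  -- Energy bounds point values uniformly, so letting the second index run to its limit gives
  -- uniform convergence. It later transfers the Dirichlet conditions to `g`, including the limits
  -- along rays.
  have hunif : ∀ δ > 0, ∀ᶠ i in l, ∀ p, (f i p - g p) ^ 2 ≤ δ := by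
    intro δ hδ
    have h1 := (hcauC.eventually (gt_mem_nhds hδ)).curry
    filter_upwards [h1] with i hi p
    have h2 : Tendsto (fun j => (f i p - f j p) ^ 2) l (𝓝 ((f i p - g p) ^ 2)) :=
      (tendsto_const_nhds.sub (hg p)).pow 2
    refine le_of_tendsto h2 ?_
    filter_upwards [hi] with j hj
    exact (hdiff i j p).trans hj.le
  have hwint : ∀ e, IntervalIntegrable (fun t => w (G.pt e t)) volume 0 (G.len e) := by
    intro e
    have h1 := intervalIntegrable_of_integrable (hwm.pow_const 2) hwsq e
    have hle := (G.len_pos e).le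
    rw [intervalIntegrable_iff_integrableOn_Icc_of_le hle] at h1 ⊢
    have h2 : MemLp (fun t => w (G.pt e t)) 2 (volume.restrict (Icc 0 (G.len e))) :=
      (memLp_two_iff_integrable_sq (hwm.comp (measurable_pt e)).aestronglyMeasurable).2 h1
    exact h2.integrable one_le_two
  -- The derivatives converge to `w` in `L²`, so their integrals over part of an edge converge.
  -- Hence `g` is an indefinite integral of `w`.
  have hgint : ∀ e, ∀ t ∈ Icc 0 (G.len e),
      g (G.pt e t) = g (G.pt e 0) + ∫ s in (0)..t, w (G.pt e s) := by
    intro e t ht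
    have h1 : Tendsto (fun i => f i (G.pt e t) - f i (G.pt e 0)) l
        (𝓝 (g (G.pt e t) - g (G.pt e 0))) := (hg _).sub (hg _)
    have h2 : Tendsto (fun i => f i (G.pt e t) - f i (G.pt e 0)) l
        (𝓝 (∫ s in (0)..t, w (G.pt e s))) := by
      rw [tendsto_iff_norm_sub_tendsto_zero]
      have h3 := (hdw.const_mul t).sqrt
      rw [mul_zero, Real.sqrt_zero] at h3
      refine squeeze_zero (fun _ => norm_nonneg _) (fun i => ?_) h3
      refine Real.le_sqrt_of_sq_le ?_
      rw [Real.norm_eq_abs, sq_abs]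
      have hle := (G.len_pos e).le
      have hsub : uIcc 0 t ⊆ uIcc 0 (G.len e) := by
        rw [uIcc_of_le ht.1, uIcc_of_le hle]; exact Icc_subset_Icc le_rfl ht.2
      have hac := (hf i).memH1.absCont e
      have hint2 : Integrable (fun p => (edgeDeriv (f i) p - w p) ^ 2) G.vol :=
        ((hf i).memH1.memLp_deriv.sub (Lp.memLp w)).integrable_sq
      have hmeas : Measurable fun p => (edgeDeriv (f i) p - w p) ^ 2 :=
        ((measurable_edgeDeriv (f i)).sub hwm).pow_const 2
      have hcongr : ∀ s ∈ Ioo 0 (G.len e), (edgeDeriv (f i) (G.pt e s) - w (G.pt e s)) ^ 2 =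
          (derivOn (f i) e s - w (G.pt e s)) ^ 2 := fun s hs => by
        rw [edgeDeriv_pt_of_mem _ e hs]
      have hv : IntervalIntegrable (fun s => derivOn (f i) e s - w (G.pt e s)) volume 0
          (G.len e) := hac.intervalIntegrable_deriv.sub (hwint e)
      have hv2 := (intervalIntegrable_congr_Ioo hle hcongr).1
        (intervalIntegrable_of_integrable hmeas hint2 e)
      have h4 := sq_integral_le_mul_integral hv hv2 le_rfl ht.1 ht.2
      have h5 : ∫ s in (0)..t, (derivOn (f i) e s - w (G.pt e s)) =
          f i (G.pt e t) - f i (G.pt e 0) - ∫ s in (0)..t, w (G.pt e s) := by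
        have hdi : IntervalIntegrable (derivOn (f i) e) volume 0 t :=
          (hac.mono hsub).intervalIntegrable_deriv
        rw [intervalIntegral.integral_sub hdi ((hwint e).mono_set hsub)]
        congr 1
        exact (hac.mono hsub).integral_deriv_eq_sub
      rw [h5, sub_zero] at h4
      refine h4.trans (mul_le_mul_of_nonneg_left ?_ ht.1)
      rw [← intervalIntegral_congr_Ioo hle hcongr]
      exact le_hasSum (hasSum_integral_vol hmeas hint2) e fun a _ =>
        intervalIntegral.integral_nonneg (G.len_pos a).le fun _ _ => sq_nonneg _
    linarith [tendsto_nhds_unique h1 h2]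
  have hgac e := absCont_and_deriv_of_eq_integral (G.len_pos e).le (hwint e) (hgint e)
  have hgm : Measurable g := measurable_of_absCont fun e => (hgac e).1
  have hgw : edgeDeriv g =ᵐ[G.vol] w := by
    rw [Filter.EventuallyEq, ae_vol_iff (measurableSet_eq_fun (measurable_edgeDeriv _) hwm)]
    intro e
    filter_upwards [(hgac e).2] with t ht htI
    rw [edgeDeriv_pt_of_mem g e htI]
    exact ht htI
  have hgm2 : Summable (mass g) := by
    have hbd : ∃ M, ∀ᶠ i in l, ∫ p, f i p ^ 2 ∂G.vol ≤ M := by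
      have h1 : Tendsto (fun i => form (f i) (f i)) l (𝓝 (‖w‖ ^ 2)) := by
        refine (hw.norm.pow 2).congr fun i => ?_
        rw [hφ, MemLp.norm_toLp_sq, form_self]
      refine ⟨C' * (‖w‖ ^ 2 + 1), ?_⟩
      filter_upwards [h1.eventually (gt_mem_nhds (lt_add_one _))] with i hi
      exact (hL2 _ (hf i)).trans (mul_le_mul_of_nonneg_left hi.le hC')
    obtain ⟨M, hM⟩ := hbd
    refine summable_of_sum_le (c := 2 * M + 2) (fun e => mass_nonneg g e) fun F => ?_
    set L := ∑ e ∈ F, G.len e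
    have hL : 0 ≤ L := Finset.sum_nonneg fun e _ => (G.len_pos e).le
    -- The total volume may be infinite, so the uniform error is chosen according to the total
    -- length `L` of the finite edge set. It then contributes a bounded amount, independent of `F`.
    obtain ⟨i, hi, hiM⟩ := ((hunif (1 + L)⁻¹ (by positivity)).and hM).exists
    have h1 : ∀ e ∈ F, mass g e ≤ 2 * mass (f i) e + 2 * (1 + L)⁻¹ * G.len e := by
      intro e _
      have h2 : ∫ t in (0)..(G.len e), (2 * f i (G.pt e t) ^ 2 + 2 * (1 + L)⁻¹) =
          2 * mass (f i) e + 2 * (1 + L)⁻¹ * G.len e := by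
        rw [intervalIntegral.integral_add
          (((hf i).memH1.absCont e).intervalIntegrable_sq.const_mul 2) intervalIntegrable_const,
          intervalIntegral.integral_const_mul, intervalIntegral.integral_const, smul_eq_mul,
          sub_zero, mul_comm (G.len e)]
        rfl
      rw [← h2]
      refine intervalIntegral.integral_mono_on (G.len_pos e).le (hgac e).1.intervalIntegrable_sq
        ((((hf i).memH1.absCont e).intervalIntegrable_sq.const_mul 2).add
          intervalIntegrable_const) fun t _ => ?_
      nlinarith [hi (G.pt e t), sq_nonneg (2 * f i (G.pt e t) - g (G.pt e t))]
    have h3 : ∑ e ∈ F, mass (f i) e ≤ M :=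
      (sum_le_hasSum F (fun e _ => mass_nonneg _ e) (hf i).memH1.hasSum_mass).trans hiM
    have h4 : (1 + L)⁻¹ * L ≤ 1 := by
      rw [inv_mul_le_iff₀ (by positivity)]; linarith
    refine (Finset.sum_le_sum h1).trans ?_
    rw [Finset.sum_add_distrib, ← Finset.mul_sum, ← Finset.mul_sum]
    change _ + 2 * (1 + L)⁻¹ * L ≤ _
    linarith
  have hgH1 : MemH1 g := by
    refine ⟨fun e => (hgac e).1, ?_, (memLp_congr_ae hgw).2 (Lp.memLp w)⟩
    rw [memLp_two_iff_integrable_sq hgm.aestronglyMeasurable]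
    exact integrable_vol_of_summable (hgm.pow_const 2) (fun p => sq_nonneg _)
      (fun e => (hgac e).1.intervalIntegrable_sq) hgm2
  refine ⟨g, ⟨hgH1, fun p hp => ?_, fun r hr => ?_⟩, ?_⟩
  · refine tendsto_nhds_unique (hg p) ?_
    simp [fun i => (hf i).eq_zero p hp]
  · rw [Metric.tendsto_nhds]
    intro ε hε
    obtain ⟨i, hi⟩ := (hunif ((ε / 2) ^ 2) (by positivity)).exists
    filter_upwards [Metric.tendsto_nhds.1 ((hf i).tendsto_zero r hr) (ε / 2) (by positivity)]
      with n hn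
    rw [Real.dist_eq, sub_zero] at hn ⊢
    have h1 := abs_le_of_sq_le_sq' (hi (.vertex (r.vert n))) (by positivity)
    rw [abs_lt] at hn ⊢
    constructor <;> linarith [h1.1, h1.2, hn.1, hn.2]
  · refine hdw.congr fun i => ?_
    rw [form_self]
    refine integral_congr_ae ?_
    filter_upwards [(hf i).memH1.edgeDeriv_sub hgH1, hgw] with p h1 h2
    rw [h1, Pi.sub_apply, h2]

/-! ### The lowest eigenvalue -/

/-- There are nontrivial functions in `H¹₀`. -/
lemma exists_memH10_dirichletSet [Countable E] [Nonempty E] (c : V) :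
    ∃ f : G.Point → ℝ, MemH10 (G.dirichletSet c) f ∧ 0 < ∫ p, f p ^ 2 ∂G.vol := by
  classical
  obtain ⟨e₀⟩ := ‹Nonempty E›
  -- A bump on a single edge vanishes at every vertex, so all Dirichlet conditions hold.
  let q : E → ℝ → ℝ := fun e t => if e = e₀ then t * (G.len e - t) else 0
  let f : G.Point → ℝ := fun p => match p with
    | .vertex _ => 0
    | .inner e t _ => q e t
  have hq : ∀ e, ContDiff ℝ 1 (q e) := by
    intro e
    by_cases he : e = e₀
    · simp only [q, if_pos he]; fun_prop
    · simp only [q, if_neg he]; fun_prop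
  have hfq : ∀ e, ∀ t ∈ Icc 0 (G.len e), f (G.pt e t) = q e t := by
    intro e t ht
    rcases ht.1.eq_or_lt with rfl | h0
    · simp [pt_zero, f, q]
    · rcases ht.2.eq_or_lt with rfl | h1
      · simp [pt_len, f, q]
      · rw [pt_of_mem e ⟨h0, h1⟩]
  have hd : ∀ e, ∀ t ∈ Ioo 0 (G.len e), derivOn f e t = deriv (q e) t := by
    intro e t ht
    refine Filter.EventuallyEq.deriv_eq ?_
    filter_upwards [isOpen_Ioo.mem_nhds ht] with s hs
    exact hfq e s (Ioo_subset_Icc_self hs)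
  have hac : ∀ e, AbsolutelyContinuousOnInterval (fun s => f (G.pt e s)) 0 (G.len e) := by
    intro e
    refine (ContDiffOn.absolutelyContinuousOnInterval (hq e).contDiffOn).congr fun t ht => ?_
    rw [uIcc_of_le (G.len_pos e).le] at ht
    exact (hfq e t ht).symm
  have hzero : ∀ e, e ≠ e₀ → q e = fun _ => 0 := fun e he => by ext t; simp [q, he]
  have hH1 : MemH1 f := by
    refine MemH1.of_summable hac (fun e => ?_) ?_ ?_
    · refine (intervalIntegrable_congr_Ioo (φ := fun t => deriv (q e) t ^ 2) (G.len_pos e).le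
        fun t ht => by rw [hd e t ht]).1 ?_
      exact (((hq e).continuous_deriv le_rfl).pow 2).intervalIntegrable _ _
    · refine summable_of_ne_finset_zero (s := {e₀}) fun e he => ?_
      rw [Finset.mem_singleton] at he
      unfold mass
      rw [intervalIntegral_congr_Ioo (G.len_pos e).le (ψ := fun _ => 0) fun t ht => by
        rw [hfq e t (Ioo_subset_Icc_self ht), hzero e he, zero_pow two_ne_zero]]
      simp
    · refine summable_of_ne_finset_zero (s := {e₀}) fun e he => ?_
      rw [Finset.mem_singleton] at he
      unfold energy
      rw [intervalIntegral_congr_Ioo (G.len_pos e).le (ψ := fun _ => 0) fun t ht => by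
        rw [hd e t ht, hzero e he, deriv_const, zero_pow two_ne_zero]]
      simp
  refine ⟨f, ⟨hH1, ?_, fun r _ => tendsto_const_nhds⟩, ?_⟩
  · rintro p (⟨γ, hγ⟩ | ⟨a, -, -, ha⟩)
    · cases hγ
    · cases ha; rfl
  · refine lt_of_lt_of_le ?_ (le_hasSum hH1.hasSum_mass e₀ fun e _ => mass_nonneg f e)
    refine intervalIntegral.intervalIntegral_pos_of_pos_on (hac e₀).intervalIntegrable_sq
      (fun t ht => ?_) (G.len_pos e₀)
    rw [hfq e₀ t (Ioo_subset_Icc_self ht)]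
    have h1 := ht.1
    have h2 := sub_pos.2 ht.2
    simp only [q, if_true]
    positivity

lemma form_smul_self (a : ℝ) (f : G.Point → ℝ) : form (a • f) (a • f) = a ^ 2 * form f f := by
  simp only [form, edgeDeriv_smul, Pi.smul_apply, smul_eq_mul]
  rw [← integral_const_mul]
  congr 1
  ext p
  ring

lemma integral_smul_sq (a : ℝ) (f : G.Point → ℝ) :
    ∫ p, (a • f) p ^ 2 ∂G.vol = a ^ 2 * ∫ p, f p ^ 2 ∂G.vol := by
  simp only [Pi.smul_apply, smul_eq_mul, mul_pow]
  rw [integral_const_mul]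

lemma MemH1.form_parallelogram [Countable E] {f g : G.Point → ℝ} (hf : MemH1 f) (hg : MemH1 g) :
    form (f - g) (f - g) + form (f + g) (f + g) = 2 * form f f + 2 * form g g := by
  have h1 := hf.form_add_smul_self hg 1
  have h2 := hf.form_add_smul_self hg (-1)
  rw [one_smul] at h1
  rw [neg_one_smul, ← sub_eq_add_neg] at h2
  linarith

lemma MemH1.integral_sq_parallelogram {f g : G.Point → ℝ} (hf : MemH1 f) (hg : MemH1 g) :
    ∫ p, (f - g) p ^ 2 ∂G.vol + ∫ p, (f + g) p ^ 2 ∂G.vol =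
      2 * ∫ p, f p ^ 2 ∂G.vol + 2 * ∫ p, g p ^ 2 ∂G.vol := by
  have h1 := hf.integral_add_smul_sq hg 1
  have h2 := hf.integral_add_smul_sq hg (-1)
  rw [one_smul] at h1
  rw [neg_one_smul, ← sub_eq_add_neg] at h2
  linarith

variable {S : Set G.Closure}

/-- If `H¹₀` is compactly embedded into `L²`, then the Rayleigh quotient has a minimizer. -/
lemma exists_minimizer [Countable E] {C C' : ℝ} (hC : 0 ≤ C) (hC' : 0 ≤ C')
    (hpt : ∀ f : G.Point → ℝ, MemH10 S f → ∀ p, f p ^ 2 ≤ C * form f f)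
    (hL2 : ∀ f : G.Point → ℝ, MemH10 S f → ∫ p, f p ^ 2 ∂G.vol ≤ C' * form f f)
    (hsample : ∀ ε > 0, ∃ (F : Finset E) (N : ℕ), ∀ f : G.Point → ℝ, MemH10 S f →
      ∫ p, f p ^ 2 ∂G.vol ≤ ε * form f f + ∑ e ∈ F, 2 * (G.len e / N) *
          ∑ k ∈ Finset.range N, f (G.pt e (k * (G.len e / N))) ^ 2)
    (hne : ∃ f : G.Point → ℝ, MemH10 S f ∧ 0 < ∫ p, f p ^ 2 ∂G.vol) :
    ∃ f : G.Point → ℝ, MemH10 S f ∧ ∫ p, f p ^ 2 ∂G.vol = 1 ∧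
      ∀ h, MemH10 S h → form f f * ∫ p, h p ^ 2 ∂G.vol ≤ form h h := by
  set Q : Set ℝ := {x | ∃ f : G.Point → ℝ, MemH10 S f ∧ ∫ p, f p ^ 2 ∂G.vol = 1 ∧ form f f = x}
    with hQ
  set lam := sInf Q with hlam
  have hnormal : ∀ h : G.Point → ℝ, MemH10 S h → 0 < ∫ p, h p ^ 2 ∂G.vol →
      (∫ p, h p ^ 2 ∂G.vol)⁻¹ * form h h ∈ Q := by
    intro h hh hpos
    set m := ∫ p, h p ^ 2 ∂G.vol
    have hs : (Real.sqrt m)⁻¹ ^ 2 = m⁻¹ := by rw [inv_pow, Real.sq_sqrt hpos.le]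
    refine ⟨(Real.sqrt m)⁻¹ • h, hh.smul _, ?_, ?_⟩
    · rw [integral_smul_sq, hs, inv_mul_cancel₀ hpos.ne']
    · rw [form_smul_self, hs]
  have hbdd : BddBelow Q := ⟨0, by rintro x ⟨f, -, -, rfl⟩; exact form_self_nonneg f⟩
  have hmin : ∀ h : G.Point → ℝ, MemH10 S h → lam * ∫ p, h p ^ 2 ∂G.vol ≤ form h h := by
    intro h hh
    rcases (integral_nonneg fun p => sq_nonneg (h p) : 0 ≤ ∫ p, h p ^ 2 ∂G.vol).eq_or_lt with h0 | h0
    · rw [← h0, mul_zero]; exact form_self_nonneg h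
    · have := csInf_le hbdd (hnormal h hh h0)
      rwa [inv_mul_eq_div, le_div_iff₀ h0] at this
  obtain ⟨u, hu1, hu2, hu3⟩ := exists_seq_tendsto_sInf (S := Q)
    (by obtain ⟨f, hf, h0⟩ := hne; exact ⟨_, hnormal f hf h0⟩) hbdd
  choose f hf hf1 hfu using hu3
  -- Along an ultrafilter the bounded values converge at all points simultaneously, with no passage
  -- to subsequences.
  set U : Filter ℕ := (hyperfilter ℕ : Filter ℕ) with hU
  have hUt : Tendsto (fun n => form (f n) (f n)) U (𝓝 lam) := by
    simp only [hfu]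
    exact hu2.mono_left Nat.hyperfilter_le_atTop
  set M := u 0
  have hM : ∀ n, form (f n) (f n) ≤ M := fun n => by rw [hfu]; exact hu1 (Nat.zero_le n)
  have hM0 : 0 ≤ M := (form_self_nonneg _).trans (hM 0)
  have hlim : ∀ p, ∃ a, Tendsto (fun n => f n p) U (𝓝 a) := by
    intro p
    have hb : ∀ n, f n p ∈ Icc (-Real.sqrt (C * M)) (Real.sqrt (C * M)) := by
      intro n
      rw [mem_Icc, ← abs_le]
      refine Real.abs_le_sqrt ((hpt _ (hf n) p).trans ?_)
      exact mul_le_mul_of_nonneg_left (hM n) hC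
    obtain ⟨a, -, ha⟩ := isCompact_Icc.ultrafilter_le_nhds ((hyperfilter ℕ).map fun n => f n p)
      (by
        rw [Ultrafilter.coe_map, le_principal_iff, mem_map]
        exact mem_of_superset univ_mem fun n _ => hb n)
    exact ⟨a, ha⟩
  choose a ha using hlim
  have hmass : Tendsto (fun x : ℕ × ℕ => ∫ p, (f x.1 - f x.2) p ^ 2 ∂G.vol) (U ×ˢ U) (𝓝 0) := by
    rw [Metric.tendsto_nhds]
    intro η hη
    -- The energy of a difference is at most `4 * M`. This choice makes the energy term at most `η /
    -- 2`, and the added `1` avoids division by zero.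
    obtain ⟨F, N, hFN⟩ := hsample (η / (2 * (4 * M + 1))) (by positivity)
    have h1 : Tendsto (fun x : ℕ × ℕ => ∑ e ∈ F, 2 * (G.len e / N) *
        ∑ k ∈ Finset.range N, (f x.1 - f x.2) (G.pt e (k * (G.len e / N))) ^ 2) (U ×ˢ U)
        (𝓝 (∑ e ∈ F, 2 * (G.len e / N) * ∑ k ∈ Finset.range N, (0 : ℝ))) := by
      refine tendsto_finsetSum _ fun e _ => (tendsto_finsetSum _ fun k _ => ?_).const_mul _
      have h2 := (((ha (G.pt e (k * (G.len e / N)))).comp tendsto_fst).sub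
        ((ha (G.pt e (k * (G.len e / N)))).comp (tendsto_snd (f := U)))).pow 2
      rw [sub_self, zero_pow two_ne_zero] at h2
      exact h2
    simp only [Finset.sum_const_zero, mul_zero] at h1
    filter_upwards [h1.eventually (gt_mem_nhds (half_pos hη))] with x hx
    rw [Real.dist_eq, sub_zero, abs_of_nonneg (integral_nonneg fun p => sq_nonneg _)]
    refine (hFN _ ((hf x.1).sub (hf x.2))).trans_lt ?_
    have h3 := (hf x.1).memH1.form_parallelogram (hf x.2).memH1
    have h4 : form (f x.1 - f x.2) (f x.1 - f x.2) ≤ 4 * M + 1 := by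
      linarith [hM x.1, hM x.2, form_self_nonneg (f x.1 + f x.2)]
    have h5 : η / (2 * (4 * M + 1)) * form (f x.1 - f x.2) (f x.1 - f x.2) ≤ η / 2 := by
      refine (mul_le_mul_of_nonneg_left h4 (by positivity)).trans (le_of_eq ?_)
      field_simp
    linarith
  -- By the parallelogram law, the energy of a difference is `2 E₁ + 2 E₂` minus the energy of the
  -- sum, where the energies `E₁` and `E₂` tend to `lam`. The energy of the sum is at least `lam`
  -- times its mass, and this mass tends to `4`.
  have hcau : Tendsto (fun x : ℕ × ℕ => form (f x.1 - f x.2) (f x.1 - f x.2)) (U ×ˢ U) (𝓝 0) := by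
    have h1 : Tendsto (fun x : ℕ × ℕ => 2 * form (f x.1) (f x.1) + 2 * form (f x.2) (f x.2) -
        lam * (4 - ∫ p, (f x.1 - f x.2) p ^ 2 ∂G.vol)) (U ×ˢ U)
        (𝓝 (2 * lam + 2 * lam - lam * (4 - 0))) :=
      (((hUt.comp tendsto_fst).const_mul 2).add ((hUt.comp tendsto_snd).const_mul 2)).sub
        ((tendsto_const_nhds.sub hmass).const_mul lam)
    have h2 : 2 * lam + 2 * lam - lam * (4 - 0) = 0 := by ring
    rw [h2] at h1
    refine squeeze_zero (fun _ => form_self_nonneg _) (fun x => ?_) h1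
    have h3 := (hf x.1).memH1.form_parallelogram (hf x.2).memH1
    have h4 := (hf x.1).memH1.integral_sq_parallelogram (hf x.2).memH1
    have h5 := hmin _ ((hf x.1).add (hf x.2))
    rw [hf1, hf1] at h4
    have h6 : ∫ p, (f x.1 + f x.2) p ^ 2 ∂G.vol = 4 - ∫ p, (f x.1 - f x.2) p ^ 2 ∂G.vol := by
      linarith
    rw [h6] at h5
    linarith
  obtain ⟨g, hg, hgt⟩ := MemH10.exists_tendsto hC' hpt hL2 hf hcau
  have hgm : Tendsto (fun n => ∫ p, (f n - g) p ^ 2 ∂G.vol) U (𝓝 0) := by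
    have h1 := hgt.const_mul C'
    rw [mul_zero] at h1
    exact squeeze_zero (fun _ => integral_nonneg fun p => sq_nonneg _)
      (fun n => hL2 _ ((hf n).sub hg)) h1
  have hform : form g g = lam := by
    have h1 : Tendsto (fun n => (hf n).memH1.memLp_deriv.toLp) U (𝓝 hg.memH1.memLp_deriv.toLp) := by
      rw [tendsto_iff_norm_sub_tendsto_zero]
      have h2 := hgt.sqrt
      rw [Real.sqrt_zero] at h2
      refine h2.congr fun n => ?_
      rw [← (hf n).memH1.norm_toLp_edgeDeriv_sub_sq hg.memH1, Real.sqrt_sq (norm_nonneg _)]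
    have h3 := h1.norm.pow 2
    simp only [MemLp.norm_toLp_sq, ← form_self] at h3
    exact tendsto_nhds_unique h3 hUt
  have hone : ∫ p, g p ^ 2 ∂G.vol = 1 := by
    have h1 : Tendsto (fun n => (hf n).memH1.memLp.toLp) U (𝓝 hg.memH1.memLp.toLp) := by
      rw [tendsto_iff_norm_sub_tendsto_zero]
      have h2 := hgm.sqrt
      rw [Real.sqrt_zero] at h2
      refine h2.congr fun n => ?_
      rw [← MemLp.toLp_sub, ← MemLp.norm_toLp_sq ((hf n).memH1.memLp.sub hg.memH1.memLp),
        Real.sqrt_sq (norm_nonneg _)]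
    have h3 := h1.norm.pow 2
    simp only [MemLp.norm_toLp_sq, hf1] at h3
    exact tendsto_nhds_unique h3 tendsto_const_nhds
  exact ⟨g, hg, hone, fun h hh => hform ▸ hmin h hh⟩

/-- A minimizer of the Rayleigh quotient is an eigenfunction for the lowest eigenvalue. -/
lemma isLeast_eigenvalues_of_minimizer [Countable E] {f : G.Point → ℝ} (hf : MemH10 S f)
    (h1 : ∫ p, f p ^ 2 ∂G.vol = 1)
    (hmin : ∀ h, MemH10 S h → form f f * ∫ p, h p ^ 2 ∂G.vol ≤ form h h) :
    IsLeast (eigenvalues S) (form f f) := by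
  set lam := form f f with hlam
  -- The Euler–Lagrange equation: the perturbation `f + t h` leaves a nonnegative quadratic
  -- polynomial in `t` without constant term, so its linear coefficient vanishes.
  have hEL : ∀ h, MemH10 S h → form f h = lam * ∫ p, f p * h p ∂G.vol := by
    intro h hh
    set B := form f h - lam * ∫ p, f p * h p ∂G.vol with hB
    set D := form h h - lam * ∫ p, h p ^ 2 ∂G.vol with hD
    have hD0 : 0 ≤ D := sub_nonneg.2 (hmin h hh)
    have h2 : ∀ t : ℝ, 0 ≤ 2 * t * B + t ^ 2 * D := by
      intro t
      have h3 := hmin _ (hf.add (hh.smul t))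
      rw [hf.memH1.form_add_smul_self hh.memH1, hf.memH1.integral_add_smul_sq hh.memH1, h1] at h3
      rw [hB, hD]
      linarith
    -- The minimizing parameter would be `-B / D`. Replacing `D` by `D + 1` also covers `D = 0`.
    have h4 := h2 (-B / (D + 1))
    have h5 : 2 * (-B / (D + 1)) * B + (-B / (D + 1)) ^ 2 * D =
        -(B ^ 2 * (D + 2)) / (D + 1) ^ 2 := by
      field_simp
      ring
    rw [h5, neg_div, Left.nonneg_neg_iff] at h4
    have h6 : B ^ 2 * (D + 2) ≤ 0 := by
      by_contra hpos
      have : 0 < B ^ 2 * (D + 2) / (D + 1) ^ 2 := div_pos (not_le.1 hpos) (by positivity)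
      linarith
    have h7 : B = 0 := by
      by_contra hB0
      have : 0 < B ^ 2 * (D + 2) := by positivity
      linarith
    linarith
  constructor
  · refine ⟨hf.memH1.memLp.toLp, ?_, f, hf, hf.memH1.memLp.coeFn_toLp, fun h hh => ?_⟩
    · intro h0
      have := hf.memH1.memLp.norm_toLp_sq
      rw [h0, h1] at this
      simp at this
    · rw [hEL h hh, ← integral_const_mul]
      refine integral_congr_ae ?_
      filter_upwards [Lp.coeFn_smul lam hf.memH1.memLp.toLp, hf.memH1.memLp.coeFn_toLp]
        with p hp1 hp2
      simp only [hp1, Pi.smul_apply, smul_eq_mul, hp2]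
      ring
  · rintro μ ⟨u, hu, g, hg, hug, hgu⟩
    -- Testing the eigenvalue equation with the eigenfunction itself shows that `μ` is its Rayleigh
    -- quotient.
    have h2 := hgu g hg
    have h3 : ∫ p, (μ • u : Lp ℝ 2 G.vol) p * g p ∂G.vol = μ * ∫ p, g p ^ 2 ∂G.vol := by
      rw [← integral_const_mul]
      refine integral_congr_ae ?_
      filter_upwards [Lp.coeFn_smul μ u, hug] with p hp1 hp2
      simp only [hp1, Pi.smul_apply, smul_eq_mul]
      rw [hp2]
      ring
    have h4 : 0 < ∫ p, g p ^ 2 ∂G.vol := by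
      have h5 : u = hg.memH1.memLp.toLp := by
        refine Lp.ext ?_
        filter_upwards [hug, hg.memH1.memLp.coeFn_toLp] with p hp1 hp2
        rw [hp1, hp2]
      rw [← hg.memH1.memLp.norm_toLp_sq, ← h5]
      have := norm_pos_iff.2 hu
      positivity
    have h6 := hmin g hg
    change form g g = ∫ p, (μ • u : Lp ℝ 2 G.vol) p * g p ∂G.vol at h2
    rw [h2, h3] at h6
    exact le_of_mul_le_mul_right h6 h4

/-! ### The main theorem -/

lemma closureDist_root_le_inradius {c : V} {ρ : ℝ≥0∞}
    (h : ∀ x ∈ S, G.closureDist (.inl (.vertex c)) x = ρ) : ρ ≤ G.inradius S := by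
  refine ENNReal.le_of_forall_nnreal_lt fun r hr => ?_
  unfold inradius
  refine le_iSup_of_le (.inl (.vertex c)) (le_iSup₂_of_le r ?_ le_rfl)
  rw [Set.disjoint_left]
  intro y hy hyS
  rw [mem_ofPred_eq, h y hyS] at hy
  exact hr.not_ge hy

/-- Every edge starts strictly below height `R`, so the finite sets of edges starting below `R - 1 /
(n + 1)` exhaust all edges. -/
lemma Rooting.countable_edges {c : V} (T : Rooting G c) {R : ℝ}
    (hH : ∀ e, T.height (T.outer e) ≤ R)
    (hfin : ∀ s < R, {e | T.height (T.inner e) ≤ s}.Finite) : Countable E := by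
  rw [← countable_univ_iff]
  have : (univ : Set E) ⊆ ⋃ n : ℕ, {e | T.height (T.inner e) ≤ R - 1 / (n + 1)} := by
    intro e _
    have h1 : 0 < R - T.height (T.inner e) := sub_pos.2 ((T.height_inner_lt e).trans_le (hH e))
    obtain ⟨n, hn⟩ := exists_nat_one_div_lt h1
    refine mem_iUnion.2 ⟨n, ?_⟩
    rw [mem_ofPred_eq]
    linarith
  refine (countable_iUnion fun n => (hfin _ ?_).countable).mono this
  have : (0 : ℝ) < 1 / (n + 1) := by positivity
  linarith

end

end MetricGraph

theorem mainTheorem7 {V E : Type*} (G : MetricGraph V E) [Nonempty E]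
    (hfin : G.LocallyFinite) (htree : G.IsTree) (c : V) (hc : G.IsCentre c)
    (hInr : G.inradius (G.dirichletSet c) ≠ ⊤) :
    ∃ lam : ℝ, IsLeast (MetricGraph.eigenvalues (G.dirichletSet c)) lam ∧
      Real.pi ^ 2 / (4 * (G.inradius (G.dirichletSet c)).toReal ^ 2) ≤ lam := by
  obtain ⟨T⟩ := htree.exists_rooting c
  obtain ⟨x₀, hx₀⟩ := MetricGraph.Rooting.dirichletSet_nonempty T
  set ρ := G.closureDist (.inl (.vertex c)) x₀ with hρ
  have hall : ∀ x ∈ G.dirichletSet c, G.closureDist (.inl (.vertex c)) x = ρ :=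
    fun x hx => hc x hx x₀ hx₀
  have hle := MetricGraph.closureDist_root_le_inradius hall
  have hρt : ρ ≠ ⊤ := ne_top_of_le_ne_top hInr hle
  set R := ρ.toReal with hRdef
  have hR : ∀ x ∈ G.dirichletSet c,
      G.closureDist (.inl (.vertex c)) x = ENNReal.ofReal R := by
    intro x hx
    rw [hall x hx, hRdef, ENNReal.ofReal_toReal hρt]
  have hH := T.height_outer_le hR ENNReal.toReal_nonneg
  have hfinite : ∀ s < R, {e | T.height (T.inner e) ≤ s}.Finite :=
    fun s hs => T.finite_height_inner_le hR hfin hs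
  have hR0 : 0 < R := by
    obtain ⟨e⟩ := ‹Nonempty E›
    exact (T.height_nonneg (T.inner e)).trans_lt ((T.height_inner_lt e).trans_le (hH e))
  have hcount : Countable E := T.countable_edges hH hfinite
  set m := Real.pi ^ 2 / (4 * R ^ 2) with hm
  have hm0 : 0 < m := by positivity
  obtain ⟨C, hC, hpt⟩ := T.exists_sq_le_mul_form hR0 hH
  obtain ⟨f, hf, h1, hmin⟩ := MetricGraph.exists_minimizer hC.le (inv_pos.2 hm0).le hpt
    (fun f hf => by
      rw [inv_mul_eq_div, le_div_iff₀' hm0]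
      exact T.mul_integral_sq_le_form hR0 hH hf)
    (fun ε hε => T.exists_integral_sq_le_sample hR0 hH hfinite hε)
    (MetricGraph.exists_memH10_dirichletSet c)
  refine ⟨MetricGraph.form f f, MetricGraph.isLeast_eigenvalues_of_minimizer hf h1 hmin, ?_⟩
  have h2 := T.mul_integral_sq_le_form hR0 hH hf
  rw [h1, mul_one] at h2
  -- The bound with `R` implies the one with the inradius, because `0 < R` and `R` is at most the
  -- inradius.
  refine le_trans ?_ h2
  have h3 : R ≤ (G.inradius (G.dirichletSet c)).toReal := ENNReal.toReal_mono hInr hle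
  gcongr
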